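/- Let $\mathcal M$ be a connected smooth ($n$-dimensional, Hausdorff, second countable, boundaryless) Riemannian manifold with Riemannian distance $d$, and let $\mathcal R:\mathcal{TM}\to\mathcal M$ be a retraction, i.e. a smooth map such that $\mathcal R_x(0_x)=x$ and $D\mathcal R_x(0_x)=\mathrm{id}_{\mathcal T_x\mathcal M}$ for all $x\in\mathcal M$, where $\mathcal R_x=\mathcal R|_{\mathcal T_x\mathcal M}$. Let $(x_n)_{n\ge 0}$ be random points of $\mathcal M$ with $$x_{n+1}=\mathcal R_{x_n}\big(a_n(H(x_n)+M_{n+1})\big),\qquad n\ge 0,$$ where $M_{n+1}$ is a random tangent vector in $\mathcal T_{x_n}\mathcal M$. Assume: (A0) the injectivity radius at every point of $\mathcal M$ is at least some $r_0>0$; (A1) $H:\mathcal M\to\mathcal{TM}$ is a smooth vector field; (A2) the step sizes satisfy $a_n>0$, $\sum_n a_n=\infty$ and $\sum_n a_n^2<\infty$; (A3) with $\mathcal F_n=\sigma(x_0,M_m,\,1\le m\le n)$, $(M_n)$ is a martingale difference sequence: $\mathbb E\|M_{n+1}\|<\infty$ and $\mathbb E[M_{n+1}\mid\mathcal F_n]=0$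 a.s. in $\mathcal T_{x_n}\mathcal M$, that is, $\mathbb E[\alpha_{x_n}(M_{n+1})\mid\mathcal F_n]=0$ a.s. for every smooth compactly supported covector field $\alpha$; moreover $\sup_n\mathbb E[\|M_{n+1}\|^2\mid\mathcal F_n]<\infty$ a.s., where $\|\cdot\|$ is the Riemannian norm; (A4) almost surely, all the iterates $x_n$ lie in a compact subset of $\mathcal M$, which may depend on the sample point. Let $t_n=\sum_{m=0}^{n-1}a_m$ and let $x(t)$, $t\ge 0$, be an interpolation of the iterates by geodesics: $x(t_n)=x_n$ and $x$ is a geodesic on each $[t_n,t_{n+1}]$, namely the minimizing one whenever $d(x_n,x_{n+1})<r_0$. For $s\ge 0$ let $x^s$ denote the solution of $\dot y=H(y)$ with $x^s(s)=x(s)$. Then for every $T>0$, almost surely, $x^s$ exists on $[s,s+T]$ for all sufficiently large $s$, and $$\lim_{s\to\infty}\ \sup_{t\in[s,s+T]}d\big(x(t),x^s(t)\big)=0.$$ -/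

import Mathlib

open Set Filter MeasureTheory Manifold Bundle
open scoped Topology ContDiff ENNReal NNReal

noncomputable section

namespace RiemannianSA

/-! ### Geodesics, exponential map, injectivity radius, retractions -/

section Geometry

variable (E : Type*) [NormedAddCommGroup E] [NormedSpace ℝ E]
  {M : Type*} [MetricSpace M] [ChartedSpace E M] [IsManifold 𝓘(ℝ, E) ∞ M]
  [RiemannianBundle (fun y : M ↦ TangentSpace 𝓘(ℝ, E) y)]

/-- `γ` is a geodesic on the (nondegenerate) interval `s`: a smooth curve of constant speed that
locally minimizes arc length, i.e. every short enough piece of it has a length equal to the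
Riemannian distance of its end points. -/
structure IsGeodesicOn (γ : ℝ → M) (s : Set ℝ) : Prop where
  smooth : ContMDiffOn 𝓘(ℝ, ℝ) 𝓘(ℝ, E) ∞ γ s
  const_speed : ∃ c : ℝ, ∀ t ∈ s,
    ‖(mfderivWithin 𝓘(ℝ, ℝ) 𝓘(ℝ, E) γ s t (1 : ℝ) : TangentSpace 𝓘(ℝ, E) (γ t))‖ = c
  locally_minimizing : ∀ t ∈ s, ∃ U ∈ 𝓝 t, ∀ a ∈ U ∩ s, ∀ b ∈ U ∩ s, a ≤ b →
    pathELength 𝓘(ℝ, E) γ a b = edist (γ a) (γ b)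

/-- `exp_x v = y`: there is a geodesic `γ` on `[0, 1]` with `γ 0 = x`, `γ' 0 = v` and
`γ 1 = y`. (The first two conditions are stated together as an equality in the tangent bundle.) -/
def ExpEq (x : M) (v : TangentSpace 𝓘(ℝ, E) x) (y : M) : Prop :=
  ∃ γ : ℝ → M, IsGeodesicOn E γ (Icc 0 1) ∧
    tangentMapWithin 𝓘(ℝ, ℝ) 𝓘(ℝ, E) γ (Icc 0 1) (⟨0, (1 : ℝ)⟩ : TangentBundle 𝓘(ℝ, ℝ) ℝ)
      = (⟨x, v⟩ : TangentBundle 𝓘(ℝ, E) M) ∧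
    γ 1 = y

/-- The injectivity radius at `x`: the supremum of the radii `r` for which `exp_x` is defined on
the open ball of radius `r` of the tangent space at `x` and is a diffeomorphism from this ball onto
its (open) image. The ball is that of the Riemannian norm at `x`. -/
def injRadius (x : M) : ℝ≥0∞ :=
  sSup {r : ℝ≥0∞ | ∃ Φ : PartialDiffeomorph 𝓘(ℝ, E) 𝓘(ℝ, E) E M ∞,
    Φ.source = {v : TangentSpace 𝓘(ℝ, E) x | ‖v‖ₑ < r} ∧
    ∀ v ∈ Φ.source, ExpEq E x v (Φ v)}

end Geometry

section Retraction

variable (E : Type*) [NormedAddCommGroup E] [NormedSpace ℝ E]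
  {M : Type*} [TopologicalSpace M] [ChartedSpace E M] [IsManifold 𝓘(ℝ, E) ∞ M]

/-- A retraction: a smooth map `R` from the tangent bundle of `M` to `M` such that `R_x 0 = x` and
`D R_x (0) = id` for all `x` (the tangent space at `x` being canonically identified with its own
tangent space at `0`). -/
structure IsRetraction (R : TangentBundle 𝓘(ℝ, E) M → M) : Prop where
  smooth : ContMDiff 𝓘(ℝ, E).tangent 𝓘(ℝ, E) ∞ R
  map_zero : ∀ x : M, R ⟨x, 0⟩ = x
  hasMFDerivAt_zero : ∀ x : M,
    HasMFDerivAt 𝓘(ℝ, E) 𝓘(ℝ, E) (fun v : E ↦ R ⟨x, v⟩) (0 : E) (ContinuousLinearMap.id ℝ E)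

end Retraction

/-! ### Interpolation of the iterates -/

/-- The times `t_n = ∑_{m < n} a_m`. -/
def stepTime (a : ℕ → ℝ) (n : ℕ) : ℝ := ∑ m ∈ Finset.range n, a m

section Interpolation

variable (E : Type*) [NormedAddCommGroup E] [NormedSpace ℝ E]
  {M : Type*} [MetricSpace M] [ChartedSpace E M] [IsManifold 𝓘(ℝ, E) ∞ M]
  [RiemannianBundle (fun y : M ↦ TangentSpace 𝓘(ℝ, E) y)]

/-- `c` interpolates the points `x n`, reached at the times `t_n`, by geodesics on the intervals
`[t_n, t_{n+1}]`. When the distance of two successive points is smaller than `r₀` (below, a lower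
bound of all the injectivity radii), the geodesic between them is the minimizing one. -/
structure IsGeodesicInterpolation (r₀ : ℝ) (a : ℕ → ℝ) (x : ℕ → M) (c : ℝ → M) : Prop where
  apply_stepTime : ∀ n, c (stepTime a n) = x n
  geodesic : ∀ n, IsGeodesicOn E c (Icc (stepTime a n) (stepTime a (n + 1)))
  minimizing : ∀ n, edist (x n) (x (n + 1)) < ENNReal.ofReal r₀ →
    pathELength 𝓘(ℝ, E) c (stepTime a n) (stepTime a (n + 1)) = edist (x n) (x (n + 1))

end Interpolation

/-! ### Noise -/

section Noise

variable (E : Type*) [NormedAddCommGroup E] [NormedSpace ℝ E]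
  {M : Type*} [TopologicalSpace M] [ChartedSpace E M] [IsManifold 𝓘(ℝ, E) ∞ M]
  {Ω : Type*}

/-- The σ-algebra `F_n` generated by `X_0` and by the noise terms `M_1, …, M_n`. Here
`ξ k w` is the value of `M_{k+1}`, a tangent vector at `X_k w`, and it is considered as a random
element of the tangent bundle. -/
abbrev history (X : ℕ → Ω → M) (ξ : ∀ (k : ℕ) (w : Ω), TangentSpace 𝓘(ℝ, E) (X k w)) (n : ℕ) :
    MeasurableSpace Ω :=
  (borel M).comap (X 0) ⊔ ⨆ k ∈ Finset.range n,
    (borel (TangentBundle 𝓘(ℝ, E) M)).comap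
      (fun w ↦ (⟨X k w, ξ k w⟩ : TangentBundle 𝓘(ℝ, E) M))

variable [RiemannianBundle (fun y : M ↦ TangentSpace 𝓘(ℝ, E) y)]

/-- The noise terms `M_{n+1} = ξ n`, tangent vectors at `X_n`, are martingale differences:
they are random elements of the tangent bundle with integrable norm, and
`𝔼[M_{n+1} | F_n] = 0` in the tangent space at the `F_n`-measurable point `X_n`. As the tangent
space depends on the random point, the latter means that `𝔼[α(M_{n+1}) | F_n] = 0` for all smooth
covector fields `α` with compact support. -/
structure IsMartingaleDifference {mΩ : MeasurableSpace Ω} (μ : Measure Ω) (X : ℕ → Ω → M)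
    (ξ : ∀ (k : ℕ) (w : Ω), TangentSpace 𝓘(ℝ, E) (X k w)) : Prop where
  measurable_init : Measurable[mΩ, borel M] (X 0)
  measurable : ∀ n, Measurable[mΩ, borel (TangentBundle 𝓘(ℝ, E) M)]
    (fun w ↦ (⟨X n w, ξ n w⟩ : TangentBundle 𝓘(ℝ, E) M))
  integrable : ∀ n, Integrable (fun w ↦ ‖ξ n w‖) μ
  condExp_eq_zero : ∀ (n : ℕ) (α : ∀ y : M, TangentSpace 𝓘(ℝ, E) y →L[ℝ] ℝ),
    ContMDiff 𝓘(ℝ, E).tangent 𝓘(ℝ, ℝ) ∞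
      (fun p : TangentBundle 𝓘(ℝ, E) M ↦ α p.proj p.snd) →
    (∃ K : Set M, IsCompact K ∧ ∀ y ∉ K, α y = 0) →
    μ[fun w ↦ α (X n w) (ξ n w) | history E X ξ n] =ᵐ[μ] 0

end Noise

end RiemannianSA

end

noncomputable section

namespace RiemannianSA

/-! ### Deterministic tracking in a vector space -/

section Tracking

/-! The argument is the classical ODE method, carried out in a vector space. A compact piece of the
manifold is mapped injectively into `V` by a compactly supported smooth `F` for which the drift
`dF(H)` is Lipschitz with respect to `F` (`exists_contMDiff_injOn_forall_norm_sub_le`). Subtraction,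
Grönwall's inequality and martingale convergence then make sense in `V`, and no parallel transport
or comparison geometry is required.

Probability. Taylor's formula along the retraction gives `F(x_{n+1}) - F(x_n) = a_n dF(H) + a_n
dF(M_{n+1}) + O(a_n² ‖H + M_{n+1}‖²)`. Since `F` is bounded, this holds for arbitrarily large
tangent vectors based in a compact set. The middle terms are scalar martingale differences,
coordinate by coordinate, because `dF` is a compactly supported covector field; truncation on the
events where the conditional second moment is at most `k` makes their sum an L²-bounded martingale.
The same truncation makes the remainders summable. Hence `F(x_n)` minus its accumulated drift
converges almost surely (`ae_cauchySeq_compensated`).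

Determinism. Once that sequence is Cauchy, its late fluctuations are uniformly small, and a discrete
Grönwall estimate keeps the iterates close to any solution started on the interpolation
(`norm_sub_le_of_tracking`). Injectivity on a compact set turns closeness in `V` into closeness in
`M`. The estimate is valid only while the solution stays in that set; a continuity argument shows
that it cannot leave (`eventually_forall_dist_lt`).

Existence follows from the same estimate: `H` is cut off outside a larger compact set, which makes
it complete, and tracking shows that the flow of the truncated field never reaches the region where
it differs from `H`. A countable exhaustion by compact sets handles the dependence of the compact
set on the sample point. -/

lemma stepTime_succ (a : ℕ → ℝ) (n : ℕ) : stepTime a (n + 1) = stepTime a n + a n :=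
  Finset.sum_range_succ _ _

lemma strictMono_stepTime {a : ℕ → ℝ} (ha : ∀ n, 0 < a n) : StrictMono (stepTime a) :=
  strictMono_nat_of_lt_succ fun n ↦ by rw [stepTime_succ]; linarith [ha n]

lemma tendsto_stepTime {a : ℕ → ℝ} (ha : ∀ n, 0 < a n) (hs : ¬ Summable a) :
    Tendsto (stepTime a) atTop atTop :=
  (not_summable_iff_tendsto_nat_atTop_of_nonneg fun n ↦ (ha n).le).1 hs

lemma exists_mem_Ico_stepTime {a : ℕ → ℝ} (h : Tendsto (stepTime a) atTop atTop) {s : ℝ}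
    (hs : 0 ≤ s) : ∃ n, stepTime a n ≤ s ∧ s < stepTime a (n + 1) := by
  classical
  have hex : ∃ m, s < stepTime a m := (h.eventually_gt_atTop s).exists
  obtain ⟨n, hn⟩ : ∃ n, Nat.find hex = n + 1 := by
    refine Nat.exists_eq_succ_of_ne_zero fun h0 ↦ ?_
    have := Nat.find_spec hex
    rw [h0] at this
    simp [stepTime] at this
    linarith
  refine ⟨n, not_lt.1 (Nat.find_min hex (by omega)), ?_⟩
  rw [← hn]
  exact Nat.find_spec hex

variable {V : Type*} [NormedAddCommGroup V] [NormedSpace ℝ V] {M : Type*}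

/-- Discrete Grönwall estimate with step sizes `a`. -/
lemma discrete_gronwall {a w : ℕ → ℝ} {L b : ℝ} (hL : 0 ≤ L) (hb : 0 ≤ b) (ha : ∀ n, 0 ≤ a n)
    {n m : ℕ} (hnm : n ≤ m) (hw0 : 0 ≤ w n)
    (hw : ∀ j, n ≤ j → j < m → w (j + 1) ≤ w j + a j * (L * (w j + b))) :
    w m + b ≤ Real.exp (L * (stepTime a m - stepTime a n)) * (w n + b) := by
  induction m, hnm using Nat.le_induction with
  | base => simp
  | succ m hnm ih =>
    have h1 := hw m hnm (Nat.lt_succ_self m)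
    have h2 := ih fun j hj hj' ↦ hw j hj (hj'.trans (Nat.lt_succ_self m))
    have h3 : w (m + 1) + b ≤ (1 + L * a m) * (w m + b) := by linarith
    have h4 : 1 + L * a m ≤ Real.exp (L * a m) := by linarith [Real.add_one_le_exp (L * a m)]
    have h5 : 0 ≤ 1 + L * a m := by have := mul_nonneg hL (ha m); linarith
    calc w (m + 1) + b ≤ (1 + L * a m) * (w m + b) := h3
      _ ≤ (1 + L * a m) * (Real.exp (L * (stepTime a m - stepTime a n)) * (w n + b)) := by gcongr
      _ ≤ Real.exp (L * a m) * (Real.exp (L * (stepTime a m - stepTime a n)) * (w n + b)) := by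
        gcongr
      _ = _ := by rw [← mul_assoc, ← Real.exp_add, stepTime_succ]; ring_nf

/-- A curve `u` whose derivative `v` satisfies `‖v r - v q‖ ≤ L ‖u r - u q‖` and `‖v‖ ≤ G` agrees
with its tangent line up to a quadratic error. -/
lemma norm_sub_sub_smul_le {u v : ℝ → V} {L G α β : ℝ} (hαβ : α ≤ β) (hL : 0 ≤ L)
    (hu : ∀ r ∈ Icc α β, HasDerivWithinAt u (v r) (Icc α β) r)
    (hv : ∀ r ∈ Icc α β, ‖v r‖ ≤ G)
    (hvL : ∀ r ∈ Icc α β, ‖v r - v α‖ ≤ L * ‖u r - u α‖) :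
    ‖u β - u α - (β - α) • v α‖ ≤ L * (G * (β - α)) * (β - α) := by
  have hα : α ∈ Icc α β := left_mem_Icc.2 hαβ
  have hβ : β ∈ Icc α β := right_mem_Icc.2 hαβ
  have hG : 0 ≤ G := (norm_nonneg _).trans (hv α hα)
  -- Mean value inequality for `u r - r • v α`: the derivative is at most `L ‖u r - u α‖`, and `u`
  -- has moved by at most `G (β - α)`.
  have key := (convex_Icc α β).norm_image_sub_le_of_norm_hasDerivWithin_le
    (f := fun r ↦ u r - r • v α) (f' := fun r ↦ v r - (1 : ℝ) • v α) (C := L * (G * (β - α)))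
    (fun r hr ↦ (hu r hr).sub ((hasDerivWithinAt_id r _).smul_const (v α)))
    (fun r hr ↦ ?_) hα hβ
  · have h1 : u β - β • v α - (u α - α • v α) = u β - u α - (β - α) • v α := by
      rw [sub_smul]; abel
    rwa [h1, Real.norm_of_nonneg (sub_nonneg.2 hαβ)] at key
  · rw [one_smul]
    refine (hvL r hr).trans (mul_le_mul_of_nonneg_left ?_ hL)
    refine ((convex_Icc α β).norm_image_sub_le_of_norm_hasDerivWithin_le hu hv hα hr).trans ?_
    rw [Real.norm_of_nonneg (sub_nonneg.2 hr.1)]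
    gcongr
    exact hr.2

/-- The value along `p` of a function `F`, compensated by the sums of the drift `g`. -/
def compensated (F g : M → V) (a : ℕ → ℝ) (p : ℕ → M) (n : ℕ) : V :=
  F (p n) - ∑ j ∈ Finset.range n, a j • g (p j)

/-- The iterates form an Euler scheme for `(F ∘ y)' = g ∘ y`, perturbed by noise whose tail sums are
at most `ε`. Grönwall runs over the grid times in `[s, t]`; the two incomplete steps at the ends
cost `O(ε)` each. -/
lemma norm_sub_le_of_tracking {F g : M → V} {K : Set M} {L G T ε : ℝ} (hL : 0 ≤ L) (hT : 0 ≤ T)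
    (hε : 0 ≤ ε) (hG0 : 0 ≤ G)
    (hgF : ∀ p ∈ K, ∀ q ∈ K, ‖g p - g q‖ ≤ L * ‖F p - F q‖) (hG : ∀ p ∈ K, ‖g p‖ ≤ G)
    {a : ℕ → ℝ} (ha : ∀ n, 0 < a n) (hat : Tendsto (stepTime a) atTop atTop)
    {p : ℕ → M} (hp : ∀ n, p n ∈ K) {c : ℝ → M} (hc : ∀ n, c (stepTime a n) = p n) {N : ℕ}
    (hD : ∀ n ≥ N, ∀ m ≥ N, ‖compensated F g a p m - compensated F g a p n‖ ≤ ε)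
    (haε : ∀ n ≥ N, a n ≤ ε)
    (hcε : ∀ n ≥ N, ∀ t ∈ Icc (stepTime a n) (stepTime a (n + 1)), ‖F (c t) - F (p n)‖ ≤ ε)
    {y : ℝ → M} {s t : ℝ} (hNs : stepTime a N ≤ s) (hst : s ≤ t) (htT : t ≤ s + T)
    (hyK : ∀ r ∈ Icc s t, y r ∈ K) (hys : y s = c s)
    (hy : ∀ r ∈ Icc s t, HasDerivWithinAt (F ∘ y) (g (y r)) (Icc s t) r) :
    ‖F (c t) - F (y t)‖ ≤ (2 + G + Real.exp (L * T) * (3 + 2 * G)) * ε := by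
  have hmono := strictMono_stepTime ha
  have h0N : 0 ≤ stepTime a N := by
    simpa [stepTime] using hmono.monotone (Nat.zero_le N)
  obtain ⟨n, hn, hn'⟩ := exists_mem_Ico_stepTime hat (h0N.trans hNs)
  obtain ⟨m, hm, hm'⟩ := exists_mem_Ico_stepTime hat (h0N.trans (hNs.trans hst))
  have hNn : N ≤ n := by
    have := hmono.lt_iff_lt.1 (hNs.trans_lt hn'); omega
  have hnm : n ≤ m := by
    have := hmono.lt_iff_lt.1 ((hn.trans hst).trans_lt hm'); omega
  have hspeed : ∀ r ∈ Icc s t, ∀ q ∈ Icc s t, r ≤ q → ‖F (y q) - F (y r)‖ ≤ G * (q - r) := by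
    intro r hr q hq hrq
    have := (convex_Icc s t).norm_image_sub_le_of_norm_hasDerivWithin_le hy
      (fun r hr ↦ hG _ (hyK r hr)) hr hq
    rwa [Real.norm_of_nonneg (sub_nonneg.2 hrq)] at this
  have hexp : 1 ≤ Real.exp (L * T) := Real.one_le_exp (by positivity)
  have hcs : ‖F (c s) - F (p n)‖ ≤ ε := hcε n hNn s ⟨hn, hn'.le⟩
  have hs_mem : s ∈ Icc s t := left_mem_Icc.2 hst
  have ht_mem : t ∈ Icc s t := right_mem_Icc.2 hst
  -- If `s` and `t` lie in the same step, there is no grid time to iterate over, and both curves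
  -- have moved by `O(ε)` only.
  rcases hnm.eq_or_lt with rfl | hlt
  · have h1 : ‖F (c t) - F (p n)‖ ≤ ε := hcε n hNn t ⟨hm, hm'.le⟩
    have h2 := hspeed s hs_mem t ht_mem hst
    have h3 : t - s ≤ ε := by
      have := haε n hNn
      rw [stepTime_succ] at hm'
      linarith
    have h4 : G * (t - s) ≤ G * ε := by gcongr
    calc ‖F (c t) - F (y t)‖
        = ‖(F (c t) - F (p n)) - (F (c s) - F (p n)) - (F (y t) - F (y s))‖ := by
          rw [hys]; congr 1; abel
      _ ≤ ε + ε + G * (t - s) := by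
          refine (norm_sub_le _ _).trans (add_le_add ((norm_sub_le _ _).trans ?_) h2)
          exact add_le_add h1 hcs
      _ ≤ (2 + G + Real.exp (L * T) * (3 + 2 * G)) * ε := by
          have : 0 ≤ Real.exp (L * T) * (3 + 2 * G) * ε := by positivity
          linarith
  · have hmem : ∀ j, n + 1 ≤ j → j ≤ m → stepTime a j ∈ Icc s t := fun j hj hj' ↦
      ⟨hn'.le.trans (hmono.monotone hj), (hmono.monotone hj').trans hm⟩
    set D := compensated F g a p with hDdef
    -- The noise is small only when summed, not in absolute value step by step. Subtracting its
    -- accumulated value gives an error with a noise-free recursion. The origin is `n + 1`, the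
    -- index of the first grid time after `s`.
    set W : ℕ → V := fun j ↦ F (p j) - F (y (stepTime a j)) - (D j - D (n + 1)) with hW
    have hDj : ∀ j ≥ n + 1, ‖D j - D (n + 1)‖ ≤ ε := fun j hj ↦
      hD (n + 1) (by omega) j (by omega)
    have hWn : ‖W (n + 1)‖ ≤ (2 + G) * ε := by
      have h1 : ‖F (p (n + 1)) - F (p n)‖ ≤ ε := by
        have := hcε n hNn (stepTime a (n + 1)) ⟨(hmono (Nat.lt_succ_self n)).le, le_rfl⟩
        rwa [hc] at this
      have h2 := hspeed s hs_mem _ (hmem (n + 1) le_rfl hlt) hn'.le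
      have h3 : stepTime a (n + 1) - s ≤ ε := by
        have := haε n hNn
        rw [stepTime_succ]
        linarith
      have h4 : G * (stepTime a (n + 1) - s) ≤ G * ε := by gcongr
      calc ‖W (n + 1)‖ = ‖(F (p (n + 1)) - F (p n)) - (F (c s) - F (p n))
            - (F (y (stepTime a (n + 1))) - F (y s))‖ := by
            rw [hW, hys]; congr 1; simp only []; abel
        _ ≤ ε + ε + G * (stepTime a (n + 1) - s) := by
            refine (norm_sub_le _ _).trans (add_le_add ((norm_sub_le _ _).trans ?_) h2)
            exact add_le_add h1 hcs
        _ ≤ (2 + G) * ε := by linarith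
    have hstep : ∀ j, n + 1 ≤ j → j < m →
        ‖W (j + 1)‖ ≤ ‖W j‖ + a j * (L * (‖W j‖ + (1 + G) * ε)) := by
      intro j hj hjm
      have hj1 := hmem j hj hjm.le
      have hj2 := hmem (j + 1) (by omega) hjm
      have haj : stepTime a (j + 1) - stepTime a j = a j := by rw [stepTime_succ]; ring
      have hsub : Icc (stepTime a j) (stepTime a (j + 1)) ⊆ Icc s t := Icc_subset_Icc hj1.1 hj2.2
      have h1 := norm_sub_sub_smul_le (u := F ∘ y) (v := fun r ↦ g (y r)) (L := L) (G := G)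
        (hmono (Nat.lt_succ_self j)).le hL (fun r hr ↦ (hy r (hsub hr)).mono hsub)
        (fun r hr ↦ hG _ (hyK r (hsub hr)))
        (fun r hr ↦ hgF _ (hyK r (hsub hr)) _ (hyK _ hj1))
      rw [haj] at h1
      simp only [Function.comp_apply] at h1
      have h2 : ‖g (p j) - g (y (stepTime a j))‖ ≤ L * (‖W j‖ + ε) := by
        refine (hgF _ (hp j) _ (hyK _ hj1)).trans (mul_le_mul_of_nonneg_left ?_ hL)
        calc ‖F (p j) - F (y (stepTime a j))‖ = ‖W j + (D j - D (n + 1))‖ := by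
              rw [hW]; congr 1; simp only []; abel
          _ ≤ ‖W j‖ + ε := (norm_add_le _ _).trans (by gcongr; exact hDj j hj)
      have h3 : W (j + 1) = W j + a j • (g (p j) - g (y (stepTime a j)))
          - (F (y (stepTime a (j + 1))) - F (y (stepTime a j)) - a j • g (y (stepTime a j))) := by
        simp only [hW, hDdef, compensated, Finset.sum_range_succ, smul_sub]
        abel
      have haε' := haε j (by omega)
      have haj0 := (ha j).le
      calc ‖W (j + 1)‖ ≤ ‖W j‖ + a j * (L * (‖W j‖ + ε)) + L * (G * a j) * a j := by
            rw [h3]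
            refine (norm_sub_le _ _).trans (add_le_add ((norm_add_le _ _).trans ?_) h1)
            gcongr
            rw [norm_smul, Real.norm_of_nonneg haj0]
            gcongr
        _ ≤ ‖W j‖ + a j * (L * (‖W j‖ + ε)) + L * (G * ε) * a j := by gcongr
        _ = _ := by ring
    -- In `b`, one `ε` is the noise inside the argument of the drift and `G ε` is the Euler error.
    -- Together with the initial error `(2 + G) ε` this gives the factor `3 + 2 G`.
    have hgron := discrete_gronwall (w := fun j ↦ ‖W j‖) hL (b := (1 + G) * ε) (by positivity)
      (fun n ↦ (ha n).le) (Nat.succ_le_of_lt hlt) (norm_nonneg _) hstep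
    have hbound : ‖W m‖ ≤ Real.exp (L * T) * (3 + 2 * G) * ε := by
      have h1 : stepTime a m - stepTime a (n + 1) ≤ T := by linarith
      have h2 : Real.exp (L * (stepTime a m - stepTime a (n + 1))) ≤ Real.exp (L * T) := by gcongr
      have h3 : 0 ≤ (1 + G) * ε := by positivity
      calc ‖W m‖ ≤ ‖W m‖ + (1 + G) * ε := by linarith
        _ ≤ _ := hgron
        _ ≤ Real.exp (L * T) * ((2 + G) * ε + (1 + G) * ε) := by
          gcongr
        _ = _ := by ring
    have hmt := hmem m hlt le_rfl
    have h1 : ‖F (c t) - F (p m)‖ ≤ ε := hcε m (hNn.trans hnm) t ⟨hm, hm'.le⟩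
    have h2 := hspeed _ hmt t ht_mem hm
    have h3 : t - stepTime a m ≤ ε := by
      have := haε m (hNn.trans hnm)
      rw [stepTime_succ] at hm'
      linarith
    have h4 : G * (t - stepTime a m) ≤ G * ε := by gcongr
    calc ‖F (c t) - F (y t)‖ = ‖(F (c t) - F (p m)) + (W m + (D m - D (n + 1)))
          - (F (y t) - F (y (stepTime a m)))‖ := by
          rw [hW]; congr 1; simp only []; abel
      _ ≤ ε + (Real.exp (L * T) * (3 + 2 * G) * ε + ε) + G * (t - stepTime a m) := by
          refine (norm_sub_le _ _).trans (add_le_add ((norm_add_le _ _).trans ?_) h2)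
          refine add_le_add h1 ((norm_add_le _ _).trans (add_le_add hbound (hDj m hlt)))
      _ ≤ _ := by linarith

end Tracking

/-! ### From closeness in the vector space to closeness in the manifold -/

section MetricTracking

variable {V : Type*} [NormedAddCommGroup V] {M : Type*} [MetricSpace M]

/-- The pairs of points of `K` at distance at least `δ` form a compact set, on which `‖F p - F q‖`
is positive, hence bounded below. This is uniform continuity of the inverse of `F`. -/
lemma exists_forall_dist_lt_of_injOn {K : Set M} (hK : IsCompact K) {F : M → V}
    (hF : ContinuousOn F K) (hinj : InjOn F K) {δ : ℝ} (hδ : 0 < δ) :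
    ∃ η > 0, ∀ p ∈ K, ∀ q ∈ K, ‖F p - F q‖ < η → dist p q < δ := by
  have hZ : IsCompact ((K ×ˢ K) ∩ {z : M × M | δ ≤ dist z.1 z.2}) :=
    (hK.prod hK).inter_right (isClosed_le continuous_const continuous_dist)
  have hcont : ContinuousOn (fun z : M × M ↦ ‖F z.1 - F z.2‖)
      ((K ×ˢ K) ∩ {z : M × M | δ ≤ dist z.1 z.2}) := by
    refine ContinuousOn.norm (ContinuousOn.sub ?_ ?_)
    · exact hF.comp continuousOn_fst fun z hz ↦ hz.1.1
    · exact hF.comp continuousOn_snd fun z hz ↦ hz.1.2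
  obtain ⟨η, hη, h⟩ := hZ.exists_forall_le' hcont (a := 0) (fun z hz ↦ by
    refine norm_pos_iff.2 (sub_ne_zero.2 fun h ↦ ?_)
    have h1 : z.1 = z.2 := hinj hz.1.1 hz.1.2 h
    have h2 : δ ≤ dist z.1 z.2 := hz.2
    rw [h1, dist_self] at h2
    exact hδ.not_ge h2)
  refine ⟨η, hη, fun p hp q hq hpq ↦ ?_⟩
  by_contra! hcon
  exact (h (p, q) ⟨⟨hp, hq⟩, hcon⟩).not_gt hpq

/-- A curve which starts in the interior of `K'`, and which is in the interior of `K'` whenever its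
past is in `K'`, does not leave `K'`. -/
lemma mapsTo_of_forall_mem_interior {K' : Set M} (hK' : IsClosed K') {y : ℝ → M} {s b : ℝ}
    (hy : ContinuousOn y (Icc s b)) (hs : y s ∈ interior K')
    (h : ∀ t ∈ Icc s b, (∀ r ∈ Icc s t, y r ∈ K') → y t ∈ interior K') :
    ∀ t ∈ Icc s b, y t ∈ interior K' := by
  by_contra! hcon
  have hB : IsCompact (Icc s b ∩ y ⁻¹' (interior K')ᶜ) :=
    isCompact_Icc.of_isClosed_subset
      (hy.preimage_isClosed_of_isClosed isClosed_Icc isOpen_interior.isClosed_compl)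
      inter_subset_left
  obtain ⟨τ, hτ, hmin⟩ := hB.exists_isLeast (by
    obtain ⟨t, ht, ht'⟩ := hcon
    exact ⟨t, ht, ht'⟩)
  have hbefore : ∀ r ∈ Ico s τ, y r ∈ K' := fun r hr ↦ by
    by_contra hr'
    exact hr.2.not_ge (hmin ⟨⟨hr.1, hr.2.le.trans hτ.1.2⟩, fun h ↦ hr' (interior_subset h)⟩)
  have hsτ : s < τ := by
    refine lt_of_le_of_ne hτ.1.1 ?_
    rintro rfl
    exact hτ.2 hs
  have hτK : y τ ∈ K' := by
    have hcw : ContinuousWithinAt y (Ico s τ) τ :=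
      (hy τ hτ.1).mono (Ico_subset_Icc_self.trans (Icc_subset_Icc_right hτ.1.2))
    have hcl : τ ∈ closure (Ico s τ) := by
      rw [closure_Ico hsτ.ne]; exact right_mem_Icc.2 hsτ.le
    exact hK'.closure_subset (hcw.mem_closure hcl fun r hr ↦ hbefore r hr)
  refine hτ.2 (h τ hτ.1 fun r hr ↦ ?_)
  rcases hr.2.eq_or_lt with rfl | hlt
  · exact hτK
  · exact hbefore r ⟨hr.1, hlt⟩

/-- Let `F : M → V` be injective and let the drift `g` be Lipschitz with respect to `F` on a compact
set `K'`. If the points `p n` belong to a compact set in the interior of `K'` and their compensated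
images under `F` converge, then an interpolation `c` of them is asymptotically close to all the
curves `y` which start on it and satisfy `(F ∘ y)' = g ∘ y` in `K'`. -/
theorem eventually_forall_dist_lt [NormedSpace ℝ V] {K K' : Set M} (hK : IsCompact K) (hK' : IsCompact K')
    (hKK' : K ⊆ interior K') {F g : M → V} (hF : Continuous F) (hinj : InjOn F K') {L G : ℝ}
    (hL : 0 ≤ L) (hG0 : 0 ≤ G)
    (hgF : ∀ p ∈ K', ∀ q ∈ K', ‖g p - g q‖ ≤ L * ‖F p - F q‖) (hG : ∀ p ∈ K', ‖g p‖ ≤ G)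
    {a : ℕ → ℝ} (ha : ∀ n, 0 < a n) (ha0 : Tendsto a atTop (𝓝 0))
    (hat : Tendsto (stepTime a) atTop atTop)
    {p : ℕ → M} (hp : ∀ n, p n ∈ K) (hD : CauchySeq (compensated F g a p))
    {c : ℝ → M} (hc : ∀ n, c (stepTime a n) = p n) {ρ : ℝ} (hρ : 0 < ρ)
    (hcp : ∀ n, dist (p n) (p (n + 1)) < ρ → ∀ t ∈ Icc (stepTime a n) (stepTime a (n + 1)),
      dist (c t) (p n) ≤ dist (p n) (p (n + 1)))
    {T : ℝ} (hT : 0 ≤ T) {δ : ℝ} (hδ : 0 < δ) :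
    ∀ᶠ s in atTop, ∀ y : ℝ → M, y s = c s → ContinuousOn y (Icc s (s + T)) →
      (∀ r ∈ Icc s (s + T), y r ∈ K' →
        HasDerivWithinAt (F ∘ y) (g (y r)) (Icc s (s + T)) r) →
      ∀ t ∈ Icc s (s + T), y t ∈ interior K' ∧ dist (c t) (y t) < δ := by
  have hKsub : K ⊆ K' := hKK'.trans interior_subset
  have hp' : ∀ n, p n ∈ K' := fun n ↦ hKsub (hp n)
  have hmono := strictMono_stepTime ha
  -- the distance of successive points tends to zero
  have hdist : ∀ θ > 0, ∀ᶠ n in atTop, dist (p n) (p (n + 1)) < θ := by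
    intro θ hθ
    obtain ⟨η, hη, h⟩ := exists_forall_dist_lt_of_injOn hK' hF.continuousOn hinj hθ
    have h1 : ∀ᶠ n in atTop,
        ‖compensated F g a p (n + 1) - compensated F g a p n‖ < η / 2 := by
      obtain ⟨N, hN⟩ := Metric.cauchySeq_iff.1 hD (η / 2) (by positivity)
      filter_upwards [eventually_ge_atTop N] with n hn
      rw [← dist_eq_norm]
      exact hN _ (by omega) _ hn
    have h2 : ∀ᶠ n in atTop, a n * G < η / 2 := by
      have : Tendsto (fun n ↦ a n * G) atTop (𝓝 0) := by simpa using ha0.mul_const G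
      exact this.eventually (gt_mem_nhds (by positivity))
    filter_upwards [h1, h2] with n h1 h2
    refine h _ (hp' n) _ (hp' (n + 1)) ?_
    -- One step in `V` is an increment of a Cauchy sequence plus a drift of size at most `a n * G`;
    -- both tend to zero.
    have h3 : F (p n) - F (p (n + 1)) = -((compensated F g a p (n + 1) - compensated F g a p n)
        + a n • g (p n)) := by
      simp only [compensated, Finset.sum_range_succ]; abel
    rw [h3, norm_neg]
    calc _ ≤ ‖compensated F g a p (n + 1) - compensated F g a p n‖ + ‖a n • g (p n)‖ :=
          norm_add_le _ _
      _ < η / 2 + η / 2 := by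
          refine add_lt_add_of_lt_of_le h1 (le_trans ?_ h2.le)
          rw [norm_smul, Real.norm_of_nonneg (ha n).le]
          exact mul_le_mul_of_nonneg_left (hG _ (hp' n)) (ha n).le
      _ = η := by ring
  have hcdist : ∀ θ > 0, ∀ᶠ n in atTop,
      ∀ t ∈ Icc (stepTime a n) (stepTime a (n + 1)), dist (c t) (p n) < θ := by
    intro θ hθ
    filter_upwards [hdist θ hθ, hdist ρ hρ] with n h1 h2 t ht
    exact (hcp n h2 t ht).trans_lt h1
  -- a neighborhood of `K` contained in `K'`
  obtain ⟨θ, hθ, hθK⟩ := hK.exists_thickening_subset_open isOpen_interior hKK'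
  obtain ⟨η, hη, hηF⟩ := exists_forall_dist_lt_of_injOn hK' hF.continuousOn hinj
    -- The bound `δ` is the desired conclusion; `θ / 2` serves to confine `y`, the other `θ / 2`
    -- being the distance from `c` to `K`.
    (lt_min hδ (half_pos hθ))
  set C := 2 + G + Real.exp (L * T) * (3 + 2 * G) with hC
  have hCpos : 0 < C := by positivity
  set ε := η / (2 * C) with hε
  have hεpos : 0 < ε := by positivity
  have hCε : C * ε < η := by
    rw [hε]
    field_simp
    linarith
  have e1 : ∀ᶠ n in atTop, ∀ m ≥ n, ∀ l ≥ n,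
      ‖compensated F g a p l - compensated F g a p m‖ ≤ ε := by
    obtain ⟨N, hN⟩ := Metric.cauchySeq_iff.1 hD ε hεpos
    filter_upwards [eventually_ge_atTop N] with n hn m hm l hl
    rw [← dist_eq_norm]
    exact (hN _ (hn.trans hl) _ (hn.trans hm)).le
  have e2 : ∀ᶠ n in atTop, a n ≤ ε := (ha0.eventually (gt_mem_nhds hεpos)).mono fun n h ↦ h.le
  have e3 : ∀ᶠ n in atTop, ∀ t ∈ Icc (stepTime a n) (stepTime a (n + 1)),
      ‖F (c t) - F (p n)‖ ≤ ε := by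
    have : ∃ κ > 0, ∀ q ∈ K, ∀ x, dist x q < κ → ‖F x - F q‖ ≤ ε := by
      have := hK.uniformContinuousAt_of_continuousAt F (fun q _ ↦ hF.continuousAt)
        (Metric.dist_mem_uniformity hεpos)
      obtain ⟨κ, hκ, h⟩ := Metric.mem_uniformity_dist.1 this
      refine ⟨κ, hκ, fun q hq x hx ↦ ?_⟩
      have h1 := h (a := q) (b := x) (by rwa [dist_comm]) hq
      simp only [mem_ofPred_eq] at h1
      rw [← dist_eq_norm, dist_comm]
      exact h1.le
    obtain ⟨κ, hκ, h⟩ := this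
    filter_upwards [hcdist κ hκ] with n hn t ht
    exact h _ (hp n) _ (hn t ht)
  obtain ⟨N, hN⟩ := eventually_atTop.1 (e1.and (e2.and (e3.and (hcdist (θ / 2) (half_pos hθ)))))
  have hN0 : 0 ≤ stepTime a N := by simpa [stepTime] using hmono.monotone (Nat.zero_le N)
  have hcθ : ∀ t, stepTime a N ≤ t → ∃ q ∈ K, dist (c t) q < θ / 2 := by
    intro t ht
    obtain ⟨n, hn, hn'⟩ := exists_mem_Ico_stepTime hat (hN0.trans ht)
    have hNn : N ≤ n := by have := hmono.lt_iff_lt.1 (ht.trans_lt hn'); omega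
    exact ⟨p n, hp n, (hN n hNn).2.2.2 t ⟨hn, hn'.le⟩⟩
  have hcK : ∀ t, stepTime a N ≤ t → c t ∈ interior K' := by
    intro t ht
    obtain ⟨q, hq, hqt⟩ := hcθ t ht
    exact hθK (Metric.mem_thickening_iff.2 ⟨q, hq, by linarith⟩)
  filter_upwards [eventually_ge_atTop (stepTime a N)] with s hs y hys hycont hyd
  -- Bootstrap: the estimate is conditional on the past of `y` being in `K'`, and its conclusion
  -- puts `y t` in the `θ`-thickening of `K`, hence in the interior of `K'`.
  have hclose : ∀ t ∈ Icc s (s + T), (∀ r ∈ Icc s t, y r ∈ K') →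
      dist (c t) (y t) < min δ (θ / 2) := by
    intro t ht hr
    have hsub : Icc s t ⊆ Icc s (s + T) := Icc_subset_Icc_right ht.2
    refine hηF _ (interior_subset (hcK t (hs.trans ht.1))) _ (hr t (right_mem_Icc.2 ht.1)) ?_
    refine lt_of_le_of_lt ?_ hCε
    exact norm_sub_le_of_tracking (K := K') hL hT hεpos.le hG0 hgF hG ha hat hp' hc
      (fun n hn m hm ↦ (hN N le_rfl).1 n hn m hm) (fun n hn ↦ (hN n hn).2.1)
      (fun n hn ↦ (hN n hn).2.2.1) hs ht.1 ht.2 hr hys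
      (fun r hr' ↦ (hyd r (hsub hr') (hr r hr')).mono hsub)
  have hmaps := mapsTo_of_forall_mem_interior hK'.isClosed hycont (by rw [hys]; exact hcK s hs)
    (fun t ht hr ↦ by
      have h1 := (hclose t ht hr).trans_le (min_le_right _ _)
      obtain ⟨q, hq, hqt⟩ := hcθ t (hs.trans ht.1)
      refine hθK (Metric.mem_thickening_iff.2 ⟨q, hq, ?_⟩)
      have := dist_triangle_left (y t) q (c t)
      linarith)
  intro t ht
  refine ⟨hmaps t ht, (hclose t ht fun r hr ↦ ?_).trans_le (min_le_left _ _)⟩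
  exact interior_subset (hmaps r ⟨hr.1, hr.2.trans ht.2⟩)

end MetricTracking

/-! ### Almost sure convergence of the noise series -/

section MartingaleConvergence

variable {Ω : Type*} {mΩ : MeasurableSpace Ω} {μ : Measure Ω} [IsProbabilityMeasure μ]

/-- A series of square integrable martingale differences with summable variances converges almost
surely. -/
theorem ae_exists_tendsto_sum_of_condExp_eq_zero (ℱ : Filtration ℕ mΩ) {Y : ℕ → Ω → ℝ}
    (hmeas : ∀ n, StronglyMeasurable[ℱ (n + 1)] (Y n)) (hLp : ∀ n, MemLp (Y n) 2 μ)
    (hcond : ∀ n, μ[Y n | ℱ n] =ᵐ[μ] 0) (hsum : Summable fun n ↦ ∫ w, Y n w ^ 2 ∂μ) :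
    ∀ᵐ w ∂μ, ∃ l, Tendsto (fun n ↦ ∑ j ∈ Finset.range n, Y j w) atTop (𝓝 l) := by
  set S : ℕ → Ω → ℝ := fun n ↦ ∑ j ∈ Finset.range n, Y j with hS
  have hSsucc : ∀ n, S (n + 1) = S n + Y n := fun n ↦ Finset.sum_range_succ _ _
  have hadp : StronglyAdapted ℱ S := by
    intro n
    refine Finset.stronglyMeasurable_sum _ fun j hj ↦ (hmeas j).mono (ℱ.mono ?_)
    exact Finset.mem_range.1 hj
  have hSLp : ∀ n, MemLp (S n) 2 μ := fun n ↦ memLp_finsetSum' _ fun j _ ↦ hLp j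
  have hint : ∀ n, Integrable (S n) μ := fun n ↦ (hSLp n).integrable (by norm_num)
  have hmart : Martingale S ℱ μ := by
    refine martingale_of_condExp_sub_eq_zero_nat hadp hint fun n ↦ ?_
    rw [hSsucc, add_sub_cancel_left]
    exact hcond n
  -- Orthogonality of martingale increments: `S n` factors out of the conditional expectation of `Y
  -- n`. The second moments of the partial sums therefore add up.
  have horth : ∀ n, ∫ w, (S n * Y n) w ∂μ = 0 := by
    intro n
    rw [← integral_condExp (ℱ.le n)]
    have h1 := condExp_mul_of_stronglyMeasurable_left (hadp n) ((hSLp n).integrable_mul (hLp n))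
      ((hLp n).integrable (by norm_num))
    have h2 : μ[S n * Y n | ℱ n] =ᵐ[μ] 0 := by
      filter_upwards [h1, hcond n] with w h1 h2
      rw [h1, Pi.mul_apply, h2, Pi.zero_apply, mul_zero]
    rw [integral_congr_ae h2]
    simp
  have hsq : ∀ n, ∫ w, S n w ^ 2 ∂μ = ∑ j ∈ Finset.range n, ∫ w, Y j w ^ 2 ∂μ := by
    intro n
    induction n with
    | zero => simp [hS]
    | succ n ih =>
      rw [Finset.sum_range_succ, ← ih, hSsucc]
      have h1 : ∀ w, (S n + Y n) w ^ 2 = S n w ^ 2 + Y n w ^ 2 + 2 * (S n * Y n) w := fun w ↦ by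
        simp only [Pi.add_apply, Pi.mul_apply]; ring
      simp_rw [h1]
      have h2 : Integrable (fun w ↦ S n w ^ 2 + Y n w ^ 2) μ :=
        (hSLp n).integrable_sq.add (hLp n).integrable_sq
      rw [integral_add h2 (((hSLp n).integrable_mul (hLp n)).const_mul 2),
        integral_add (hSLp n).integrable_sq (hLp n).integrable_sq, integral_const_mul, horth]
      simp
  -- An L¹ bound suffices for martingale convergence; it follows from `|x| ≤ 1 + x²`.
  set B : ℝ := 1 + ∑' n, ∫ w, Y n w ^ 2 ∂μ
  have hbound : ∀ n, eLpNorm (S n) 1 μ ≤ (B.toNNReal : ℝ≥0∞) := by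
    intro n
    rw [eLpNorm_one_eq_lintegral_enorm, ← ofReal_integral_norm_eq_lintegral_enorm (hint n)]
    refine ENNReal.ofReal_le_ofReal ?_
    have h1 : ∫ w, ‖S n w‖ ∂μ ≤ ∫ w, (1 + S n w ^ 2) ∂μ := by
      refine integral_mono (hint n).norm ((integrable_const 1).add (hSLp n).integrable_sq)
        fun w ↦ ?_
      simp only [Real.norm_eq_abs]
      nlinarith [sq_abs (S n w), sq_nonneg (|S n w| - 1), abs_nonneg (S n w)]
    refine h1.trans ?_
    rw [integral_add (integrable_const 1) (hSLp n).integrable_sq, hsq]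
    simp only [integral_const, probReal_univ, smul_eq_mul, mul_one, B]
    gcongr
    exact hsum.sum_le_tsum _ fun j _ ↦ integral_nonneg fun w ↦ sq_nonneg _
  filter_upwards [hmart.submartingale.exists_ae_tendsto_of_bdd hbound] with w hw
  simpa [hS] using hw

/-- Martingale differences whose conditional second moments are almost surely bounded: the series
weighted by square summable step sizes converges almost surely. -/
theorem ae_exists_tendsto_sum_of_condLExp_lt_top (ℱ : Filtration ℕ mΩ) {a : ℕ → ℝ}
    (ha : Summable fun n ↦ a n ^ 2) {Z : ℕ → Ω → ℝ≥0∞}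
    (hZ : ∀ᵐ w ∂μ, ⨆ n, (μ⁻[Z n | ℱ n]) w < ⊤) {d : ℕ → Ω → ℝ}
    (hmeas : ∀ n, StronglyMeasurable[ℱ (n + 1)] (d n)) (hint : ∀ n, Integrable (d n) μ)
    (hcond : ∀ n, μ[d n | ℱ n] =ᵐ[μ] 0) {C : ℝ≥0} (hdZ : ∀ n w, ‖d n w‖ₑ ^ 2 ≤ C * Z n w) :
    ∀ᵐ w ∂μ, ∃ l, Tendsto (fun n ↦ ∑ j ∈ Finset.range n, a j * d j w) atTop (𝓝 l) := by
  -- Truncation on an `ℱ n`-measurable event preserves the martingale difference property and bounds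
  -- the variance by `a n ^ 2 * C * k`. Almost every sample point lies in `A k n` for all `n` once
  -- `k` is large, so nothing is lost.
  set A : ℕ → ℕ → Set Ω := fun k n ↦ {w | (μ⁻[Z n | ℱ n]) w ≤ k} with hA
  have hAm : ∀ k n, MeasurableSet[ℱ n] (A k n) := fun k n ↦
    measurableSet_le (measurable_condLExp _ _ _) measurable_const
  have key : ∀ k : ℕ, ∀ᵐ w ∂μ, ∃ l,
      Tendsto (fun n ↦ ∑ j ∈ Finset.range n, (A k j).indicator (a j • d j) w) atTop (𝓝 l) := by
    intro k
    have hsm : ∀ n, StronglyMeasurable[ℱ (n + 1)] ((A k n).indicator (a n • d n)) := fun n ↦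
      ((hmeas n).const_smul (a n)).indicator (ℱ.mono (Nat.le_succ n) _ (hAm k n))
    have hlint : ∀ n, ∫⁻ w, ‖(A k n).indicator (a n • d n) w‖ₑ ^ 2 ∂μ
        ≤ ENNReal.ofReal (a n ^ 2 * (C * k)) := by
      intro n
      calc ∫⁻ w, ‖(A k n).indicator (a n • d n) w‖ₑ ^ 2 ∂μ
          = ∫⁻ w, (A k n).indicator (fun w ↦ ‖a n * d n w‖ₑ ^ 2) w ∂μ := by
            congr 1 with w
            by_cases hw : w ∈ A k n <;> simp [hw]
        _ = ∫⁻ w in A k n, ‖a n * d n w‖ₑ ^ 2 ∂μ := lintegral_indicator (ℱ.le n _ (hAm k n)) _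
        _ ≤ ∫⁻ w in A k n, ENNReal.ofReal (a n ^ 2) * C * Z n w ∂μ := by
            refine lintegral_mono fun w ↦ ?_
            rw [enorm_mul, mul_pow, mul_assoc]
            refine mul_le_mul' (le_of_eq ?_) (hdZ n w)
            rw [← enorm_pow, Real.enorm_of_nonneg (sq_nonneg _)]
        _ = ENNReal.ofReal (a n ^ 2) * C * ∫⁻ w in A k n, Z n w ∂μ :=
            lintegral_const_mul' _ _ (by finiteness)
        _ ≤ ENNReal.ofReal (a n ^ 2) * C * k := by
            gcongr
            rw [← setLIntegral_condLExp (ℱ.le n) μ (Z n) (hAm k n)]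
            calc ∫⁻ w in A k n, (μ⁻[Z n | ℱ n]) w ∂μ ≤ ∫⁻ _ in A k n, (k : ℝ≥0∞) ∂μ :=
                  setLIntegral_mono' (ℱ.le n _ (hAm k n)) fun w hw ↦ hw
              _ ≤ k := by
                  rw [setLIntegral_const]
                  exact (mul_le_mul_right prob_le_one _).trans_eq (mul_one _)
        _ = ENNReal.ofReal (a n ^ 2 * (C * k)) := by
            rw [ENNReal.ofReal_mul (sq_nonneg _), ENNReal.ofReal_mul C.coe_nonneg, mul_assoc]
            simp
    have hLp : ∀ n, MemLp ((A k n).indicator (a n • d n)) 2 μ := by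
      intro n
      refine ⟨((hsm n).mono (ℱ.le _)).aestronglyMeasurable, ?_⟩
      rw [eLpNorm_lt_top_iff_lintegral_rpow_enorm_lt_top (by norm_num) (by norm_num)]
      simp only [ENNReal.toReal_ofNat, ENNReal.rpow_ofNat]
      exact (hlint n).trans_lt ENNReal.ofReal_lt_top
    refine ae_exists_tendsto_sum_of_condExp_eq_zero ℱ hsm hLp (fun n ↦ ?_) ?_
    · have h1 := condExp_indicator (m := ℱ n) ((hint n).smul (a n)) (hAm k n)
      have h2 := condExp_smul (μ := μ) (a n) (d n) (ℱ n)
      filter_upwards [h1, h2, hcond n] with w h1 h2 h3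
      rw [h1]
      by_cases hw : w ∈ A k n <;> simp [hw, h2, h3]
    · refine Summable.of_nonneg_of_le (fun n ↦ integral_nonneg fun w ↦ sq_nonneg _) (fun n ↦ ?_)
        (ha.mul_right (C * k : ℝ))
      rw [integral_eq_lintegral_of_nonneg_ae (ae_of_all _ fun w ↦ sq_nonneg _)
        ((hLp n).aestronglyMeasurable.pow 2)]
      refine ENNReal.toReal_le_of_le_ofReal (by positivity) (le_trans (le_of_eq ?_) (hlint n))
      congr 1 with w
      rw [← enorm_pow, Real.enorm_of_nonneg (sq_nonneg _)]
  filter_upwards [ae_all_iff.2 key, hZ] with w hw hZw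
  obtain ⟨k, hk⟩ := ENNReal.exists_nat_gt hZw.ne
  obtain ⟨l, hl⟩ := hw k
  refine ⟨l, hl.congr fun n ↦ Finset.sum_congr rfl fun j _ ↦ ?_⟩
  have : w ∈ A k j := (le_iSup (fun n ↦ (μ⁻[Z n | ℱ n]) w) j).trans hk.le
  simp [this]

/-- Random variables whose conditional expectations are almost surely bounded: the series weighted
by summable weights converges almost surely. -/
theorem ae_tsum_mul_lt_top_of_condLExp_lt_top (ℱ : Filtration ℕ mΩ) {b : ℕ → ℝ≥0∞}
    (hb : ∑' n, b n ≠ ⊤) {Z : ℕ → Ω → ℝ≥0∞} (hZm : ∀ n, AEMeasurable (Z n) μ)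
    (hZ : ∀ᵐ w ∂μ, ⨆ n, (μ⁻[Z n | ℱ n]) w < ⊤) :
    ∀ᵐ w ∂μ, ∑' n, b n * Z n w < ⊤ := by
  set A : ℕ → ℕ → Set Ω := fun k n ↦ {w | (μ⁻[Z n | ℱ n]) w ≤ k} with hA
  have hAm : ∀ k n, MeasurableSet[ℱ n] (A k n) := fun k n ↦
    measurableSet_le (measurable_condLExp _ _ _) measurable_const
  have key : ∀ k : ℕ, ∀ᵐ w ∂μ, ∑' n, (A k n).indicator (fun w ↦ b n * Z n w) w < ⊤ := by
    intro k
    have hm : ∀ n, AEMeasurable ((A k n).indicator (fun w ↦ b n * Z n w)) μ := fun n ↦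
      ((hZm n).const_mul _).indicator (ℱ.le n _ (hAm k n))
    refine ae_lt_top' (AEMeasurable.tsum hm) ?_
    rw [lintegral_tsum hm]
    refine ne_top_of_le_ne_top (ENNReal.mul_ne_top hb (ENNReal.natCast_ne_top k)) ?_
    rw [← ENNReal.tsum_mul_right]
    refine ENNReal.tsum_le_tsum fun n ↦ ?_
    rw [lintegral_indicator (ℱ.le n _ (hAm k n)),
      lintegral_const_mul' _ _ (ENNReal.ne_top_of_tsum_ne_top hb n)]
    gcongr
    rw [← setLIntegral_condLExp (ℱ.le n) μ (Z n) (hAm k n)]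
    calc ∫⁻ w in A k n, (μ⁻[Z n | ℱ n]) w ∂μ ≤ ∫⁻ _ in A k n, (k : ℝ≥0∞) ∂μ :=
          setLIntegral_mono' (ℱ.le n _ (hAm k n)) fun w hw ↦ hw
      _ ≤ k := by
          rw [setLIntegral_const]
          exact (mul_le_mul_right prob_le_one _).trans_eq (mul_one _)
  filter_upwards [ae_all_iff.2 key, hZ] with w hw hZw
  obtain ⟨k, hk⟩ := ENNReal.exists_nat_gt hZw.ne
  refine lt_of_le_of_lt (le_of_eq (tsum_congr fun n ↦ ?_)) (hw k)
  have : w ∈ A k n := (le_iSup (fun n ↦ (μ⁻[Z n | ℱ n]) w) n).trans hk.le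
  simp [this]

end MartingaleConvergence

/-! ### Differentials of vector-valued functions along a vector field -/

section Drift

variable {E : Type*} [NormedAddCommGroup E] [NormedSpace ℝ E]
  {M : Type*} [TopologicalSpace M] [ChartedSpace E M]
  {V : Type*} [NormedAddCommGroup V] [NormedSpace ℝ V]

/-- The differential of `F` at `x`, with values in the vector space `V`. -/
def differential (F : M → V) (x : M) : TangentSpace 𝓘(ℝ, E) x →L[ℝ] V :=
  mfderiv 𝓘(ℝ, E) 𝓘(ℝ, V) F x

/-- The differential of `F` in the direction of the vector field `H`. -/
def drift (F : M → V) (H : ∀ y : M, TangentSpace 𝓘(ℝ, E) y) (x : M) : V :=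
  differential F x (H x)

lemma contMDiff_differential_apply [IsManifold 𝓘(ℝ, E) ∞ M] {F : M → V} (hF : ContMDiff 𝓘(ℝ, E) 𝓘(ℝ, V) ∞ F) :
    ContMDiff 𝓘(ℝ, E).tangent 𝓘(ℝ, V) ∞
      (fun p : TangentBundle 𝓘(ℝ, E) M ↦ differential F p.proj p.snd) :=
  (contMDiff_snd_tangentBundle_modelSpace V 𝓘(ℝ, V)).comp
    (hF.contMDiff_tangentMap (m := ∞) (by simp))

lemma contMDiff_drift [IsManifold 𝓘(ℝ, E) ∞ M] {F : M → V} (hF : ContMDiff 𝓘(ℝ, E) 𝓘(ℝ, V) ∞ F)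
    {H : ∀ y : M, TangentSpace 𝓘(ℝ, E) y}
    (hH : ContMDiff 𝓘(ℝ, E) 𝓘(ℝ, E).tangent ∞
      (fun y : M ↦ (⟨y, H y⟩ : TangentBundle 𝓘(ℝ, E) M))) :
    ContMDiff 𝓘(ℝ, E) 𝓘(ℝ, V) ∞ (drift F H) :=
  (contMDiff_differential_apply hF).comp hH

lemma hasDerivWithinAt_comp_of_hasMFDerivWithinAt {F : M → V}
    (hF : ContMDiff 𝓘(ℝ, E) 𝓘(ℝ, V) ∞ F) {H : ∀ y : M, TangentSpace 𝓘(ℝ, E) y}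
    {γ : ℝ → M} {s : Set ℝ} {t : ℝ}
    (hγ : HasMFDerivWithinAt 𝓘(ℝ, ℝ) 𝓘(ℝ, E) γ s t ((1 : ℝ →L[ℝ] ℝ).smulRight (H (γ t)))) :
    HasDerivWithinAt (F ∘ γ) (drift F H (γ t)) s t := by
  have h1 := ((hF.mdifferentiable (by simp)) (γ t)).hasMFDerivAt.comp_hasMFDerivWithinAt t hγ
  have key : ∀ (A : E →L[ℝ] V) (u : E),
      HasFDerivWithinAt (F ∘ γ) (A.comp ((1 : ℝ →L[ℝ] ℝ).smulRight u)) s t →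
      HasDerivWithinAt (F ∘ γ) (A u) s t := fun A u h ↦ by simpa using h.hasDerivWithinAt
  exact key (mfderiv 𝓘(ℝ, E) 𝓘(ℝ, V) F (γ t)) (H (γ t)) h1.hasFDerivWithinAt

lemma differential_eq_zero_of_notMem_tsupport {F : M → V} {x : M} (hx : x ∉ tsupport F) : differential (E := E) F x = 0 := by
  have h : F =ᶠ[𝓝 x] fun _ ↦ 0 := notMem_tsupport_iff_eventuallyEq.1 hx
  change mfderiv 𝓘(ℝ, E) 𝓘(ℝ, V) F x = 0
  rw [h.mfderiv_eq]
  exact mfderiv_const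

lemma differential_clm_comp {V' : Type*} [NormedAddCommGroup V'] [NormedSpace ℝ V'] {F : M → V} (hF : ContMDiff 𝓘(ℝ, E) 𝓘(ℝ, V) ∞ F)
    (ℓ : V →L[ℝ] V') (x : M) (v : TangentSpace 𝓘(ℝ, E) x) :
    differential (fun y ↦ ℓ (F y)) x v = ℓ (differential F x v) := by
  have h := (ℓ.hasMFDerivAt (x := F x)).comp x (hF.mdifferentiable (by simp) x).hasMFDerivAt
  have h' : mfderiv 𝓘(ℝ, E) 𝓘(ℝ, V') (fun y ↦ ℓ (F y)) x = _ := h.mfderiv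
  change mfderiv 𝓘(ℝ, E) 𝓘(ℝ, V') (fun y ↦ ℓ (F y)) x v = _
  rw [h']
  rfl

end Drift

/-! ### Integral curves and completeness -/

section IntegralCurves

variable {E : Type*} [NormedAddCommGroup E] [NormedSpace ℝ E] [CompleteSpace E]
  {M : Type*} [TopologicalSpace M] [ChartedSpace E M] [IsManifold 𝓘(ℝ, E) 1 M]
  {v : ∀ y : M, TangentSpace 𝓘(ℝ, E) y}

/-- Local existence of integral curves, on a time interval which is uniform with respect to the
initial condition. -/
theorem exists_forall_eventually_isMIntegralCurveOn {x₀ : M}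
    (hv : ContMDiffAt 𝓘(ℝ, E) 𝓘(ℝ, E).tangent 1
      (fun x ↦ (⟨x, v x⟩ : TangentBundle 𝓘(ℝ, E) M)) x₀) :
    ∃ ε > 0, ∀ᶠ x in 𝓝 x₀, ∃ γ : ℝ → M, γ 0 = x ∧ IsMIntegralCurveOn γ v (Ioo (-ε) ε) := by
  rw [contMDiffAt_iff] at hv
  obtain ⟨_, hv⟩ := hv
  have hv' := (hv.contDiffAt
    (range_mem_nhds_isInteriorPoint BoundarylessManifold.isInteriorPoint)).snd
  obtain ⟨ε, hε, a, r, L, K, hr, hpl⟩ := IsPicardLindelof.of_contDiffAt_one hv'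
  obtain ⟨α, hα, hαc⟩ := (hpl 0).exists_forall_mem_closedBall_eq_hasDerivWithinAt_continuousOn
  simp only [zero_sub, zero_add] at hα hαc
  set e := extChartAt 𝓘(ℝ, E) x₀ with he
  have hopen : IsOpen e.target := isOpen_extChartAt_target x₀
  have h0 : α (e x₀, 0) = e x₀ := (hα (e x₀) (Metric.mem_closedBall_self r.2)).1
  have hcont : ContinuousAt α (e x₀, 0) := hαc.continuousAt
    (prod_mem_nhds (Metric.closedBall_mem_nhds _ hr) (Icc_mem_nhds (by linarith) hε))
  -- Joint continuity of the Picard–Lindelöf flow in initial point and time keeps all nearby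
  -- solutions inside the chart for a common time.
  have htarget : ∀ᶠ z in 𝓝 (e x₀) ×ˢ 𝓝 (0 : ℝ), α z ∈ e.target := by
    rw [← nhds_prod_eq]
    exact hcont.eventually_mem (by rw [h0]; exact hopen.mem_nhds (mem_extChartAt_target x₀))
  obtain ⟨U, hU, W, hW, hUW⟩ := Filter.eventually_prod_iff.1 htarget
  obtain ⟨κ, hκ, hκW⟩ := Metric.eventually_nhds_iff_ball.1 hW
  refine ⟨min ε κ, lt_min hε hκ, ?_⟩
  have hec : ContinuousAt e x₀ := continuousAt_extChartAt x₀
  filter_upwards [hec.eventually hU, hec.eventually (Metric.closedBall_mem_nhds _ hr),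
    extChartAt_source_mem_nhds (I := 𝓘(ℝ, E)) x₀] with x hxU hxr hxs
  obtain ⟨hx0, hxd⟩ := hα (e x) hxr
  refine ⟨fun t ↦ e.symm (α (e x, t)), by simp only [hx0]; exact e.left_inv hxs, ?_⟩
  intro t ht
  have ht' : t ∈ Ioo (-ε) ε := ⟨by linarith [ht.1, min_le_left ε κ], ht.2.trans_le (min_le_left _ _)⟩
  have hmem : α (e x, t) ∈ e.target := by
    refine hUW hxU (hκW t ?_)
    rw [Real.ball_eq_Ioo]
    exact ⟨by linarith [ht.1, min_le_right ε κ], by linarith [ht.2, min_le_right ε κ]⟩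
  set f : ℝ → E := fun t ↦ α (e x, t) with hf
  let xₜ : M := e.symm (f t)
  have h : HasDerivAt f (fderivWithin ℝ (extChartAt 𝓘(ℝ, E) x₀ ∘ (extChartAt 𝓘(ℝ, E) xₜ).symm)
      (range 𝓘(ℝ, E)) (extChartAt 𝓘(ℝ, E) xₜ xₜ) (v xₜ)) t :=
    (hxd t (Ioo_subset_Icc_self ht')).hasDerivAt (Icc_mem_nhds ht'.1 ht'.2)
  rw [← tangentCoordChange_def] at h
  have hft1 := mem_preimage.mp <|
    mem_of_mem_of_subset hmem (extChartAt 𝓘(ℝ, E) x₀).target_subset_preimage_source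
  have hft2 := mem_extChartAt_source (I := 𝓘(ℝ, E)) xₜ
  obtain ⟨u, hu⟩ : ∃ u : E, u = v xₜ := ⟨v xₜ, rfl⟩
  -- The ODE is solved in the chart at `x₀`, while the manifold derivative at time `t` is read in
  -- the chart at `xₜ`; the two coordinate changes cancel.
  have hu1 : tangentCoordChange 𝓘(ℝ, E) x₀ xₜ xₜ (tangentCoordChange 𝓘(ℝ, E) xₜ x₀ xₜ u) = u :=
    (tangentCoordChange_comp ⟨⟨hft2, hft1⟩, hft2⟩).trans (tangentCoordChange_self hft2)
  have hcoord : HasFDerivAt (extChartAt 𝓘(ℝ, E) xₜ ∘ (extChartAt 𝓘(ℝ, E) x₀).symm)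
      (tangentCoordChange 𝓘(ℝ, E) x₀ xₜ xₜ) (f t) := by
    have := hasFDerivWithinAt_tangentCoordChange (I := 𝓘(ℝ, E)) ⟨hft1, hft2⟩
    rw [(extChartAt 𝓘(ℝ, E) x₀).right_inv hmem] at this
    exact this.hasFDerivAt (by simp)
  have hder : HasDerivAt ((extChartAt 𝓘(ℝ, E) xₜ ∘ (extChartAt 𝓘(ℝ, E) x₀).symm) ∘ f) u t := by
    rw [← hu1, hu]
    exact hcoord.comp_hasDerivAt t h
  have hder' : HasFDerivAt ((extChartAt 𝓘(ℝ, E) xₜ ∘ (extChartAt 𝓘(ℝ, E) x₀).symm) ∘ f)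
      ((1 : ℝ →L[ℝ] ℝ).smulRight u) t := by
    rw [ContinuousLinearMap.smulRight_one_eq_toSpanSingleton]
    exact hder.hasFDerivAt
  rw [hu] at hder'
  exact HasMFDerivAt.hasMFDerivWithinAt
    ⟨ContinuousAt.comp (f := f) (continuousAt_extChartAt_symm'' hmem) h.continuousAt,
      hder'.hasFDerivWithinAt⟩

/-- A vector field of class `C^1` with compact support is complete. -/
theorem exists_isMIntegralCurve_of_isCompact [T2Space M]
    (hv : ContMDiff 𝓘(ℝ, E) 𝓘(ℝ, E).tangent 1
      (fun x ↦ (⟨x, v x⟩ : TangentBundle 𝓘(ℝ, E) M)))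
    {K : Set M} (hK : IsCompact K) (hvK : ∀ x ∉ K, v x = 0) (x : M) :
    ∃ γ : ℝ → M, γ 0 = x ∧ IsMIntegralCurve γ v := by
  have hunif : ∃ ε > 0, ∀ x ∈ K, ∃ γ : ℝ → M, γ 0 = x ∧ IsMIntegralCurveOn γ v (Ioo (-ε) ε) := by
    refine hK.induction_on (p := fun s ↦ ∃ ε > 0, ∀ x ∈ s, ∃ γ : ℝ → M, γ 0 = x ∧
      IsMIntegralCurveOn γ v (Ioo (-ε) ε)) ⟨1, one_pos, by simp⟩ ?_ ?_ ?_
    · rintro s t hst ⟨ε, hε, h⟩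
      exact ⟨ε, hε, fun x hx ↦ h x (hst hx)⟩
    · rintro s t ⟨ε, hε, h⟩ ⟨ε', hε', h'⟩
      refine ⟨min ε ε', lt_min hε hε', ?_⟩
      rintro x (hx | hx)
      · obtain ⟨γ, h0, hγ⟩ := h x hx
        exact ⟨γ, h0, hγ.mono (Ioo_subset_Ioo (neg_le_neg (min_le_left _ _)) (min_le_left _ _))⟩
      · obtain ⟨γ, h0, hγ⟩ := h' x hx
        exact ⟨γ, h0, hγ.mono (Ioo_subset_Ioo (neg_le_neg (min_le_right _ _)) (min_le_right _ _))⟩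
    · intro x _
      obtain ⟨ε, hε, h⟩ := exists_forall_eventually_isMIntegralCurveOn (hv x)
      exact ⟨_, mem_nhdsWithin_of_mem_nhds h, ε, hε, fun y hy ↦ hy⟩
  obtain ⟨ε, hε, h⟩ := hunif
  -- A lifespan independent of the starting point forces global existence. Outside `K` the constant
  -- curve serves.
  refine exists_isMIntegralCurve_of_isMIntegralCurveOn hv hε (fun x ↦ ?_) x
  by_cases hx : x ∈ K
  · exact h x hx
  · exact ⟨fun _ ↦ x, rfl, (isMIntegralCurve_const (hvK x hx)).isMIntegralCurveOn _⟩

end IntegralCurves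

/-! ### Control of the geodesic interpolation -/

section Geodesics

variable {E : Type*} [NormedAddCommGroup E] [NormedSpace ℝ E]
  {M : Type*} [MetricSpace M] [ChartedSpace E M]
  [RiemannianBundle (fun y : M ↦ TangentSpace 𝓘(ℝ, E) y)] [IsRiemannianManifold 𝓘(ℝ, E) M]

/-- The distance is at most the length of the initial piece, which is at most the length of the
whole minimizing segment. -/
lemma IsGeodesicInterpolation.dist_le {r₀ : ℝ} {a : ℕ → ℝ} {x : ℕ → M} {c : ℝ → M}
    (hc : IsGeodesicInterpolation E r₀ a x c) {n : ℕ} (hn : dist (x n) (x (n + 1)) < r₀)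
    {t : ℝ} (ht : t ∈ Icc (stepTime a n) (stepTime a (n + 1))) :
    dist (c t) (x n) ≤ dist (x n) (x (n + 1)) := by
  have hsm : ContMDiffOn 𝓘(ℝ, ℝ) 𝓘(ℝ, E) 1 c (Icc (stepTime a n) t) :=
    ((hc.geodesic n).smooth.of_le (by simp)).mono (Icc_subset_Icc_right ht.2)
  have h1 : edist (x n) (c t) ≤ pathELength 𝓘(ℝ, E) c (stepTime a n) t := by
    rw [IsRiemannianManifold.out (I := 𝓘(ℝ, E)) (x n) (c t)]
    exact riemannianEDist_le_pathELength hsm (hc.apply_stepTime n) rfl ht.1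
  have h2 := h1.trans (pathELength_mono le_rfl ht.2)
  rw [hc.minimizing n (by
    rw [edist_dist]
    exact (ENNReal.ofReal_lt_ofReal_iff (dist_nonneg.trans_lt hn)).2 hn)] at h2
  rw [dist_comm, dist_edist, dist_edist]
  exact ENNReal.toReal_mono (edist_ne_top _ _) h2

end Geodesics

/-! ### Injective maps of compact sets into a vector space, with Lipschitz control -/

section LipschitzDrift

/-- A function `g` which is locally Lipschitz with respect to an injective function `F` on a compact
set is globally so. -/
lemma exists_forall_norm_sub_le {M V V' : Type*} [TopologicalSpace M] [NormedAddCommGroup V]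
    [NormedAddCommGroup V'] {K : Set M} (hK : IsCompact K) {F : M → V} {g : M → V'}
    (hF : Continuous F) (hg : Continuous g) (hinj : InjOn F K)
    (hloc : ∀ p ∈ K, ∃ C ≥ 0, ∃ U ∈ 𝓝 p, ∀ x ∈ U, ∀ y ∈ U, ‖g x - g y‖ ≤ C * ‖F x - F y‖) :
    ∃ L ≥ 0, ∀ x ∈ K, ∀ y ∈ K, ‖g x - g y‖ ≤ L * ‖F x - F y‖ := by
  have key : ∃ L ≥ 0, ∀ z ∈ K ×ˢ K, ‖g z.1 - g z.2‖ ≤ L * ‖F z.1 - F z.2‖ := by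
    refine (hK.prod hK).induction_on (p := fun s ↦ ∃ L ≥ 0, ∀ z ∈ s,
      ‖g z.1 - g z.2‖ ≤ L * ‖F z.1 - F z.2‖) ⟨0, le_rfl, by simp⟩ ?_ ?_ ?_
    · rintro s t hst ⟨L, hL, h⟩
      exact ⟨L, hL, fun z hz ↦ h z (hst hz)⟩
    · rintro s t ⟨L, hL, h⟩ ⟨L', hL', h'⟩
      refine ⟨max L L', hL.le.trans (le_max_left _ _), ?_⟩
      rintro z (hz | hz)
      · exact (h z hz).trans (by gcongr; exact le_max_left _ _)
      · exact (h' z hz).trans (by gcongr; exact le_max_right _ _)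
    · rintro ⟨p, q⟩ ⟨hp, hq⟩
      simp only at hp hq
      -- Near the diagonal the local hypothesis applies. Away from it `‖F p - F q‖` is bounded
      -- below, so boundedness of `g` is enough.
      by_cases hpq : p = q
      · subst hpq
        obtain ⟨C, hC, U, hU, h⟩ := hloc p hp
        exact ⟨U ×ˢ U, mem_nhdsWithin_of_mem_nhds (prod_mem_nhds hU hU), C, hC,
          fun z hz ↦ h _ hz.1 _ hz.2⟩
      · have hpos : 0 < ‖F p - F q‖ :=
          norm_pos_iff.2 (sub_ne_zero.2 fun h ↦ hpq (hinj hp hq h))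
        have c1 : Continuous fun z : M × M ↦ ‖F z.1 - F z.2‖ := by fun_prop
        have c2 : Continuous fun z : M × M ↦ ‖g z.1 - g z.2‖ := by fun_prop
        have e1 : ∀ᶠ z in 𝓝 (p, q), ‖F p - F q‖ / 2 < ‖F z.1 - F z.2‖ :=
          c1.continuousAt.eventually (lt_mem_nhds (half_lt_self hpos))
        have e2 : ∀ᶠ z in 𝓝 (p, q), ‖g z.1 - g z.2‖ < ‖g p - g q‖ + 1 :=
          c2.continuousAt.eventually (gt_mem_nhds (lt_add_one _))
        refine ⟨_, mem_nhdsWithin_of_mem_nhds (e1.and e2),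
          (‖g p - g q‖ + 1) / (‖F p - F q‖ / 2), by positivity, ?_⟩
        rintro z ⟨hz1, hz2⟩
        rw [div_mul_eq_mul_div, le_div_iff₀ (by positivity)]
        gcongr
  obtain ⟨L, hL, h⟩ := key
  exact ⟨L, hL, fun x hx y hy ↦ h (x, y) ⟨hx, hy⟩⟩

variable {E : Type*} [NormedAddCommGroup E] [NormedSpace ℝ E] [FiniteDimensional ℝ E]
  {M : Type*} [TopologicalSpace M] [ChartedSpace E M]

/-- Compactness yields a finite index set, which keeps the target `t → E × ℝ` of the embedding
finite-dimensional. -/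
lemma exists_smoothBumpCovering {K : Set M} (hK : IsCompact K) :
    ∃ t : Finset M, Nonempty (SmoothBumpCovering t 𝓘(ℝ, E) M K) := by
  have b : ∀ x : M, SmoothBumpFunction 𝓘(ℝ, E) x := fun x ↦ Classical.arbitrary _
  obtain ⟨t, htK, ht⟩ := hK.elim_nhds_subcover (fun x ↦ {y | b x =ᶠ[𝓝 y] 1})
    (fun x _ ↦ eventually_eventually_nhds.2 (b x).eventuallyEq_one)
  refine ⟨t, ⟨⟨fun i ↦ i, fun i ↦ b i, fun i ↦ htK _ i.2, locallyFinite_of_finite _,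
    fun x hx ↦ ?_⟩⟩⟩
  obtain ⟨i, hi, hxi⟩ := mem_iUnion₂.1 (ht hx)
  exact ⟨⟨i, hi⟩, hxi⟩

/-- A compact subset of a manifold can be embedded into a vector space in such a way that a given
smooth function `g` is Lipschitz with respect to the embedding. -/
theorem exists_contMDiff_injOn_forall_norm_sub_le [T2Space M]
    [IsManifold 𝓘(ℝ, E) ∞ M] {K : Set M} (hK : IsCompact K) :
    ∃ (t : Finset M) (F : M → t → E × ℝ), ContMDiff 𝓘(ℝ, E) 𝓘(ℝ, t → E × ℝ) ∞ F ∧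
      HasCompactSupport F ∧ InjOn F K ∧
      ∀ {V : Type _} [NormedAddCommGroup V] [NormedSpace ℝ V] (g : M → V),
        ContMDiff 𝓘(ℝ, E) 𝓘(ℝ, V) ∞ g →
        ∃ L ≥ 0, ∀ p ∈ K, ∀ q ∈ K, ‖g p - g q‖ ≤ L * ‖F p - F q‖ := by
  obtain ⟨t, ⟨f⟩⟩ := exists_smoothBumpCovering (E := E) hK
  -- Whitney's construction: the component `f i x` detects that a point is in the domain of the
  -- `i`-th chart, and where `f i = 1` the other component is the chart itself. The latter gives the
  -- Lipschitz bound, since `g` read in a chart is `C¹`.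
  set F : M → t → E × ℝ := fun x i ↦ (f i x • extChartAt 𝓘(ℝ, E) (f.c i) x, f i x) with hFeq
  have hFs : ContMDiff 𝓘(ℝ, E) 𝓘(ℝ, t → E × ℝ) ∞ F := contMDiff_pi_space.2 fun i ↦
    ((f i).contMDiff_smul contMDiffOn_extChartAt).prodMk_space (f i).contMDiff
  have hinj : InjOn F K := by
    intro x hx y _ h
    simp only [hFeq, funext_iff] at h
    obtain ⟨h₁, h₂⟩ := Prod.mk_inj.1 (h (f.ind x hx))
    rw [f.apply_ind x hx] at h₂
    rw [← h₂, f.apply_ind x hx, one_smul, one_smul] at h₁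
    have := f.mem_extChartAt_source_of_eq_one h₂.symm
    exact (extChartAt 𝓘(ℝ, E) (f.c _)).injOn (f.mem_extChartAt_ind_source x hx) this h₁
  refine ⟨t, F, hFs, ?_, hinj, ?_⟩
  · refine HasCompactSupport.intro' (K := ⋃ i, tsupport (f i))
      (isCompact_iUnion fun i ↦ (f i).hasCompactSupport) ?_ fun x hx ↦ ?_
    · exact isClosed_iUnion_of_finite fun i ↦ isClosed_tsupport _
    · have hx' : ∀ i, f i x = 0 := fun i ↦
        image_eq_zero_of_notMem_tsupport fun h ↦ hx (mem_iUnion.2 ⟨i, h⟩)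
      rw [hFeq]
      ext i <;> simp [hx']
  · intro V _ _ g hg
    refine exists_forall_norm_sub_le hK hFs.continuous hg.continuous hinj
      fun p hp ↦ ?_
    set i := f.ind p hp
    set e := extChartAt 𝓘(ℝ, E) (f.c i) with he
    have hpe : p ∈ e.source := f.mem_extChartAt_ind_source p hp
    have hsm : ContDiffAt ℝ 1 (g ∘ e.symm) (e p) := by
      have h1 : ContMDiffOn 𝓘(ℝ, E) 𝓘(ℝ, V) ∞ (g ∘ e.symm) e.target :=
        hg.comp_contMDiffOn (contMDiffOn_extChartAt_symm _)
      have h2 := h1.contMDiffAt ((isOpen_extChartAt_target _).mem_nhds (e.map_source hpe))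
      exact h2.contDiffAt.of_le (by simp)
    obtain ⟨C, s, hs, hC⟩ := hsm.exists_lipschitzOnWith
    refine ⟨C, C.2, _, inter_mem (f.eventuallyEq_one p hp) (inter_mem
      ((isOpen_extChartAt_source _).mem_nhds hpe)
      ((continuousAt_extChartAt' hpe).preimage_mem_nhds hs)), ?_⟩
    rintro x ⟨hx1, hx2, hx3⟩ y ⟨hy1, hy2, hy3⟩
    have h1 := hC.dist_le_mul (e x) hx3 (e y) hy3
    simp only [Function.comp_apply, dist_eq_norm] at h1
    rw [e.left_inv hx2, e.left_inv hy2] at h1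
    refine h1.trans ?_
    gcongr
    have hx1' : f i x = 1 := hx1
    have hy1' : f i y = 1 := hy1
    have h2 : ((F x - F y) i).1 = e x - e y := by
      rw [hFeq]
      simp only [Pi.sub_apply, Prod.fst_sub, hx1', hy1', one_smul, he]
    rw [← h2]
    exact (norm_fst_le _).trans (norm_le_pi_norm _ i)

end LipschitzDrift

/-! ### Taylor's formula with uniform quadratic remainder -/

section Taylor

/-- First order Taylor formula with a quadratic remainder which is locally uniform. -/
lemma exists_nhds_forall_norm_sub_sub_fderiv_le {W V : Type*} [NormedAddCommGroup W]
    [NormedSpace ℝ W] [NormedAddCommGroup V] [NormedSpace ℝ V] {ψ : W → V} {q₀ : W}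
    (hψ : ContDiffAt ℝ 2 ψ q₀) :
    ∃ C ≥ 0, ∃ κ > 0, ∀ q ∈ Metric.ball q₀ κ, DifferentiableAt ℝ ψ q ∧
      ∀ q' ∈ Metric.ball q₀ κ, ‖ψ q' - ψ q - fderiv ℝ ψ q (q' - q)‖ ≤ C * ‖q' - q‖ ^ 2 := by
  obtain ⟨C, s, hs, hC⟩ := (hψ.fderiv_right (m := 1) (by norm_num)).exists_lipschitzOnWith
  have hd : ∀ᶠ q in 𝓝 q₀, DifferentiableAt ℝ ψ q :=
    (hψ.eventually (by simp)).mono fun q hq ↦ hq.differentiableAt (by simp)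
  obtain ⟨κ, hκ, h⟩ := Metric.mem_nhds_iff.1 (inter_mem hs hd)
  refine ⟨C, C.2, κ, hκ, fun q hq ↦ ⟨(h hq).2, fun q' hq' ↦ ?_⟩⟩
  have hseg : segment ℝ q q' ⊆ Metric.ball q₀ κ := (convex_ball _ _).segment_subset hq hq'
  have := (convex_segment q q').norm_image_sub_le_of_norm_fderiv_le' (𝕜 := ℝ) (f := ψ)
    (φ := fderiv ℝ ψ q) (C := C * ‖q' - q‖) (fun x hx ↦ (h (hseg hx)).2) (fun x hx ↦ ?_)
    (left_mem_segment ℝ q q') (right_mem_segment ℝ q q')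
  · rwa [pow_two, ← mul_assoc]
  · have h1 := hC.dist_le_mul x (h (hseg hx)).1 q (h hq).1
    rw [dist_eq_norm, dist_eq_norm] at h1
    refine h1.trans ?_
    gcongr
    obtain ⟨u, v, hu, hv, huv, rfl⟩ := hx
    have : u • q + v • q' - q = v • (q' - q) := by
      rw [eq_sub_of_add_eq huv, sub_smul, one_smul, smul_sub]; abel
    rw [this, norm_smul, Real.norm_of_nonneg hv]
    exact mul_le_of_le_one_left (norm_nonneg _) (by linarith)

end Taylor

/-! ### Taylor's formula along a retraction -/

section RetractionTaylor

variable {E : Type*} [NormedAddCommGroup E] [NormedSpace ℝ E]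
  {M : Type*} [TopologicalSpace M] [ChartedSpace E M] [IsManifold 𝓘(ℝ, E) ∞ M]

lemma IsRetraction.hasDerivAt_comp_smul {R : TangentBundle 𝓘(ℝ, E) M → M}
    (hR : IsRetraction E R) {f : M → ℝ} (hf : ContMDiff 𝓘(ℝ, E) 𝓘(ℝ, ℝ) ∞ f) (x : M)
    (v : TangentSpace 𝓘(ℝ, E) x) :
    HasDerivAt (fun τ : ℝ ↦ f (R ⟨x, τ • v⟩)) (differential f x v) 0 := by
  have h1 : ∀ y, y = x → HasMFDerivAt 𝓘(ℝ, E) 𝓘(ℝ, ℝ) f y (mfderiv 𝓘(ℝ, E) 𝓘(ℝ, ℝ) f x) := by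
    rintro y rfl
    exact (hf.mdifferentiable (by simp) y).hasMFDerivAt
  have h2 := (h1 _ (hR.map_zero x)).comp (0 : E) (hR.hasMFDerivAt_zero x)
  have key : ∀ (A : E →L[ℝ] ℝ) (φ : E → ℝ) (u : E), HasFDerivAt φ (A.comp (.id ℝ E)) (0 : E) →
      HasDerivAt (fun τ : ℝ ↦ φ (τ • u)) (A u) 0 := by
    intro A φ u hA
    rw [ContinuousLinearMap.comp_id] at hA
    have h3 : HasDerivAt (fun τ : ℝ ↦ τ • u) u 0 := by
      simpa using (hasDerivAt_id (0 : ℝ)).smul_const u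
    have hA' : HasFDerivAt φ A ((0 : ℝ) • u) := by rwa [zero_smul]
    exact hA'.comp_hasDerivAt (0 : ℝ) h3
  exact key (mfderiv 𝓘(ℝ, E) 𝓘(ℝ, ℝ) f x) _ v h2.hasFDerivAt

lemma extChartAt_tangent_apply {p x : M} (hx : x ∈ (chartAt E p).source)
    (v : TangentSpace 𝓘(ℝ, E) x) :
    extChartAt 𝓘(ℝ, E).tangent (⟨p, 0⟩ : TangentBundle 𝓘(ℝ, E) M) ⟨x, v⟩ =
      (extChartAt 𝓘(ℝ, E) p x,
        (trivializationAt E (TangentSpace 𝓘(ℝ, E)) p).continuousLinearMapAt ℝ x v) := by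
  have hb : x ∈ (trivializationAt E (TangentSpace 𝓘(ℝ, E)) p).baseSet := by
    simpa using hx
  rw [Trivialization.continuousLinearMapAt_apply, Trivialization.coe_linearMapAt_of_mem _ hb]
  rfl

lemma mem_extChartAt_tangent_source {p x : M} (hx : x ∈ (chartAt E p).source)
    (v : TangentSpace 𝓘(ℝ, E) x) :
    (⟨x, v⟩ : TangentBundle 𝓘(ℝ, E) M) ∈
      (extChartAt 𝓘(ℝ, E).tangent (⟨p, 0⟩ : TangentBundle 𝓘(ℝ, E) M)).source := by
  rw [extChartAt_source]
  simpa [TangentBundle.mem_chart_source_iff] using hx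

variable [RiemannianBundle (fun y : M ↦ TangentSpace 𝓘(ℝ, E) y)]
  [IsContinuousRiemannianBundle E (fun y : M ↦ TangentSpace 𝓘(ℝ, E) y)]

/-- In a chart of the tangent bundle, `f ∘ R` is expanded at `(x, 0)` in the fibre direction; its
derivative there is `df` because `D R_x(0) = id`. The constant `C₁` compares the norm in the
trivialization with the Riemannian norm, uniformly near `p`. -/
lemma IsRetraction.exists_eventually_taylor {R : TangentBundle 𝓘(ℝ, E) M → M}
    (hR : IsRetraction E R) {f : M → ℝ} (hf : ContMDiff 𝓘(ℝ, E) 𝓘(ℝ, ℝ) ∞ f) (p : M) :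
    ∃ C ≥ 0, ∃ κ > 0, ∀ᶠ x in 𝓝 p, ∀ v : TangentSpace 𝓘(ℝ, E) x, ‖v‖ < κ →
      |f (R ⟨x, v⟩) - f x - differential f x v| ≤ C * ‖v‖ ^ 2 := by
  set Φ := extChartAt 𝓘(ℝ, E).tangent (⟨p, 0⟩ : TangentBundle 𝓘(ℝ, E) M) with hΦ
  set ψ : E × E → ℝ := (f ∘ R) ∘ Φ.symm with hψ
  have hp : p ∈ (chartAt E p).source := mem_chart_source E p
  have hsmooth : ContDiffAt ℝ 2 ψ (Φ ⟨p, 0⟩) := by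
    have h1 : ContMDiffOn 𝓘(ℝ, E × E) 𝓘(ℝ, ℝ) ∞ ψ Φ.target := by
      have := (hf.comp hR.smooth).comp_contMDiffOn
        (contMDiffOn_extChartAt_symm (I := 𝓘(ℝ, E).tangent) (n := ∞)
          (⟨p, 0⟩ : TangentBundle 𝓘(ℝ, E) M))
      exact this
    have h2 := h1.contMDiffAt (x := Φ ⟨p, 0⟩) ((isOpen_extChartAt_target _).mem_nhds
      (mem_extChartAt_target (I := 𝓘(ℝ, E).tangent) _))
    exact h2.contDiffAt.of_le (by norm_cast)
  obtain ⟨C, hC, κ, hκ, h⟩ := exists_nhds_forall_norm_sub_sub_fderiv_le hsmooth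
  have hΦp : Φ ⟨p, 0⟩ = (extChartAt 𝓘(ℝ, E) p p, (0 : E)) := by
    rw [hΦ, extChartAt_tangent_apply hp]
    exact Prod.ext rfl (ContinuousLinearMap.map_zero _)
  obtain ⟨C₁, hC₁, hnorm⟩ := eventually_norm_trivializationAt_lt E
    (fun x : M ↦ TangentSpace 𝓘(ℝ, E) x) p
  refine ⟨C * C₁ ^ 2, by positivity, κ / C₁, by positivity, ?_⟩
  have hchart : ∀ᶠ x in 𝓝 p, extChartAt 𝓘(ℝ, E) p x ∈ Metric.ball (extChartAt 𝓘(ℝ, E) p p) κ :=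
    (continuousAt_extChartAt p).eventually (Metric.ball_mem_nhds _ hκ)
  filter_upwards [hchart, hnorm, (chartAt E p).open_source.mem_nhds hp] with x hx1 hx2 hx3 v hv
  set w : E := (trivializationAt E (TangentSpace 𝓘(ℝ, E)) p).continuousLinearMapAt ℝ x v with hw
  have hwv : ‖w‖ ≤ C₁ * ‖v‖ :=
    (ContinuousLinearMap.le_opNorm _ _).trans (by gcongr)
  have hwκ : ‖w‖ < κ := hwv.trans_lt (by rwa [lt_div_iff₀' hC₁] at hv)
  have hcurve : ∀ τ : ℝ, ψ (extChartAt 𝓘(ℝ, E) p x, τ • w) = f (R ⟨x, τ • v⟩) := by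
    intro τ
    have h1 : Φ ⟨x, τ • v⟩ = (extChartAt 𝓘(ℝ, E) p x, τ • w) := by
      rw [hΦ, extChartAt_tangent_apply hx3, map_smul]
    rw [← h1, hψ, Function.comp_apply, Φ.left_inv (mem_extChartAt_tangent_source hx3 _)]
    rfl
  have hball : ∀ u : E, ‖u‖ < κ → (extChartAt 𝓘(ℝ, E) p x, u) ∈ Metric.ball (Φ ⟨p, 0⟩) κ := by
    intro u hu
    rw [hΦp, ← ball_prod_same]
    exact ⟨hx1, by simpa using hu⟩
  obtain ⟨hd, hbound⟩ := h _ (hball 0 (by simpa using hκ))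
  have hb := hbound _ (hball w hwκ)
  have hder : fderiv ℝ ψ (extChartAt 𝓘(ℝ, E) p x, 0) (0, w)
      = differential f x v := by
    have h1 : HasDerivAt (fun τ : ℝ ↦ (extChartAt 𝓘(ℝ, E) p x, τ • w)) ((0 : E), w) 0 := by
      have := (hasDerivAt_id (0 : ℝ)).smul_const w
      rw [one_smul] at this
      exact (hasDerivAt_const (0 : ℝ) _).prodMk this
    have hd' : HasFDerivAt ψ (fderiv ℝ ψ (extChartAt 𝓘(ℝ, E) p x, 0))
        (extChartAt 𝓘(ℝ, E) p x, (0 : ℝ) • w) := by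
      rw [zero_smul]; exact hd.hasFDerivAt
    have h2 := hd'.comp_hasDerivAt (0 : ℝ) h1
    have h3 := hR.hasDerivAt_comp_smul hf x v
    refine h2.unique (h3.congr_of_eventuallyEq (Eventually.of_forall fun τ ↦ ?_))
    exact hcurve τ
  have h0 := hcurve 0
  have h1 := hcurve 1
  rw [zero_smul, zero_smul, hR.map_zero] at h0
  rw [one_smul, one_smul] at h1
  have hsub : ((extChartAt 𝓘(ℝ, E) p x, w) : E × E) - (extChartAt 𝓘(ℝ, E) p x, 0) = (0, w) := by
    simp
  rw [hsub, hder, h0, h1] at hb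
  refine hb.trans ?_
  have h2 : ‖((0 : E), w)‖ = ‖w‖ := by simp
  rw [h2, mul_assoc, ← mul_pow]
  gcongr

/-- Taylor formula for a bounded smooth function along a retraction, uniform over a compact set, and
valid for all tangent vectors, together with a uniform bound of the differential. -/
theorem IsRetraction.exists_forall_taylor {R : TangentBundle 𝓘(ℝ, E) M → M}
    (hR : IsRetraction E R) {f : M → ℝ} (hf : ContMDiff 𝓘(ℝ, E) 𝓘(ℝ, ℝ) ∞ f)
    {B : ℝ} (hB : ∀ x, |f x| ≤ B) {K : Set M} (hK : IsCompact K) :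
    ∃ C ≥ 0, ∀ x ∈ K, ∀ v : TangentSpace 𝓘(ℝ, E) x,
      |f (R ⟨x, v⟩) - f x - differential f x v| ≤ C * ‖v‖ ^ 2 ∧
      |differential f x v| ≤ C * ‖v‖ := by
  refine hK.induction_on (p := fun s ↦ ∃ C ≥ 0, ∀ x ∈ s, ∀ v : TangentSpace 𝓘(ℝ, E) x,
      |f (R ⟨x, v⟩) - f x - differential f x v| ≤ C * ‖v‖ ^ 2 ∧
      |differential f x v| ≤ C * ‖v‖) ⟨0, le_rfl, by simp⟩ ?_ ?_ ?_
  · rintro s t hst ⟨C, hC, h⟩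
    exact ⟨C, hC, fun x hx ↦ h x (hst hx)⟩
  · rintro s t ⟨C, hC, h⟩ ⟨C', hC', h'⟩
    refine ⟨max C C', hC.le.trans (le_max_left _ _), ?_⟩
    rintro x (hx | hx) v
    · exact ⟨(h x hx v).1.trans (by gcongr; exact le_max_left _ _),
        (h x hx v).2.trans (by gcongr; exact le_max_left _ _)⟩
    · exact ⟨(h' x hx v).1.trans (by gcongr; exact le_max_right _ _),
        (h' x hx v).2.trans (by gcongr; exact le_max_right _ _)⟩
  · intro p _
    obtain ⟨C, hC, κ, hκ, h⟩ := hR.exists_eventually_taylor hf p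
    have hB0 : 0 ≤ B := (abs_nonneg _).trans (hB p)
    -- `C₁` bounds `df`, by testing the local formula on vectors of length `κ / 2`. For `‖v‖ ≥ κ`
    -- the crude bound `2 B + C₁ ‖v‖` is absorbed into a multiple of `‖v‖²`; this is what allows
    -- unbounded noise.
    set C₁ : ℝ := (2 * B + C * (κ / 2) ^ 2) / (κ / 2) with hC₁
    have hC₁0 : 0 ≤ C₁ := by positivity
    set C₂ : ℝ := max (max C C₁) (2 * B / κ ^ 2 + C₁ / κ) with hC₂
    clear_value C₁ C₂
    refine ⟨_, mem_nhdsWithin_of_mem_nhds h, C₂, ?_, ?_⟩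
    all_goals subst hC₂
    · exact hC.trans ((le_max_left _ _).trans (le_max_left _ _))
    · intro x hx v
      have hlin : |differential f x v| ≤ C₁ * ‖v‖ := by
        rcases eq_or_ne v 0 with rfl | hv
        · simp
        have hv0 : 0 < ‖v‖ := norm_pos_iff.2 hv
        set u : TangentSpace 𝓘(ℝ, E) x := (κ / 2 / ‖v‖) • v with hu
        have hun : ‖u‖ = κ / 2 := by
          rw [hu, norm_smul, Real.norm_of_nonneg (by positivity)]
          field_simp
        have h1 := hx u (by rw [hun]; linarith)
        have h2 : differential f x u
            = κ / 2 / ‖v‖ * differential f x v := by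
          rw [hu, map_smul, smul_eq_mul]
        rw [h2, hun] at h1
        have h3 : |κ / 2 / ‖v‖ * differential f x v|
            ≤ 2 * B + C * (κ / 2) ^ 2 := by
          have b1 := abs_le.1 (hB (R ⟨x, u⟩))
          have b2 := abs_le.1 (hB x)
          rw [abs_le] at h1 ⊢
          constructor <;> linarith [h1.1, h1.2]
        rw [abs_mul, abs_of_nonneg (by positivity : 0 ≤ κ / 2 / ‖v‖)] at h3
        rw [hC₁, div_mul_eq_mul_div, le_div_iff₀ (by positivity)]
        calc |differential f x v| * (κ / 2)
            = κ / 2 / ‖v‖ * |differential f x v| * ‖v‖ := by field_simp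
          _ ≤ _ := by gcongr
      refine ⟨?_, hlin.trans (by gcongr; exact (le_max_right _ _).trans (le_max_left _ _))⟩
      rcases lt_or_ge ‖v‖ κ with hv | hv
      · exact (hx v hv).trans (by gcongr; exact (le_max_left _ _).trans (le_max_left _ _))
      · have h1 : |f (R ⟨x, v⟩) - f x - differential f x v| ≤ 2 * B + C₁ * ‖v‖ := by
          have b1 := abs_le.1 (hB (R ⟨x, v⟩))
          have b2 := abs_le.1 (hB x)
          have b3 := abs_le.1 hlin
          rw [abs_le]
          constructor <;> linarith [b3.1, b3.2]
        have h2 : 2 * B ≤ 2 * B / κ ^ 2 * ‖v‖ ^ 2 := by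
          rw [div_mul_eq_mul_div, le_div_iff₀ (by positivity)]
          gcongr
        have h3 : C₁ * ‖v‖ ≤ C₁ / κ * ‖v‖ ^ 2 := by
          rw [div_mul_eq_mul_div, le_div_iff₀ hκ, pow_two, ← mul_assoc]
          gcongr
        calc _ ≤ 2 * B + C₁ * ‖v‖ := h1
          _ ≤ (2 * B / κ ^ 2 + C₁ / κ) * ‖v‖ ^ 2 := by linarith
          _ ≤ _ := by gcongr; exact le_max_right _ _

end RetractionTaylor

/-! ### Convergence of the compensated iterates -/

section Noise

variable {E : Type*} [NormedAddCommGroup E] [NormedSpace ℝ E]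
  {M : Type*} [TopologicalSpace M] [ChartedSpace E M] [IsManifold 𝓘(ℝ, E) ∞ M]

variable [RiemannianBundle (fun y : M ↦ TangentSpace 𝓘(ℝ, E) y)]

lemma exists_forall_norm_le_of_isCompact
    [IsContinuousRiemannianBundle E (fun y : M ↦ TangentSpace 𝓘(ℝ, E) y)]
    {H : ∀ y : M, TangentSpace 𝓘(ℝ, E) y}
    (hH : Continuous (fun y : M ↦ (⟨y, H y⟩ : TangentBundle 𝓘(ℝ, E) M))) {K : Set M}
    (hK : IsCompact K) : ∃ B ≥ 0, ∀ x ∈ K, ‖H x‖ ≤ B := by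
  have hc : Continuous fun x ↦ ‖H x‖ := by
    have h1 : Continuous fun x ↦ Real.sqrt (inner ℝ (H x) (H x)) :=
      (hH.inner_bundle hH).sqrt
    refine h1.congr fun x ↦ ?_
    rw [norm_eq_sqrt_real_inner]
  obtain ⟨B, hB⟩ := (hK.image hc).bddAbove
  exact ⟨max B 0, le_max_right _ _, fun x hx ↦ (hB ⟨x, hx, rfl⟩).trans (le_max_left _ _)⟩

variable {Ω : Type*} {mΩ : MeasurableSpace Ω} {μ : Measure Ω}
  {X : ℕ → Ω → M} {ξ : ∀ (n : ℕ) (w : Ω), TangentSpace 𝓘(ℝ, E) (X n w)}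

/-- The filtration generated by the initial point and by the noise. -/
def IsMartingaleDifference.filtration (hξ : IsMartingaleDifference E μ X ξ) : Filtration ℕ mΩ where
  seq := history E X ξ
  mono' := fun _ _ hnm ↦ sup_le_sup_left
    (biSup_mono fun _ hk ↦ Finset.range_subset_range.2 hnm hk) _
  le' := fun _ ↦ sup_le hξ.measurable_init.comap_le
    (iSup₂_le fun k _ ↦ (hξ.measurable k).comap_le)

/-- The index is `n + 1` because `ξ n` stands for `M_{n+1}`, which enters the history at that time.
-/
lemma IsMartingaleDifference.stronglyMeasurable_comp (hξ : IsMartingaleDifference E μ X ξ) (n : ℕ)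
    {φ : TangentBundle 𝓘(ℝ, E) M → ℝ} (hφ : Continuous φ) :
    StronglyMeasurable[hξ.filtration (n + 1)] (fun w ↦ φ ⟨X n w, ξ n w⟩) := by
  have h1 : Measurable[hξ.filtration (n + 1), borel (TangentBundle 𝓘(ℝ, E) M)]
      (fun w ↦ (⟨X n w, ξ n w⟩ : TangentBundle 𝓘(ℝ, E) M)) := by
    rw [measurable_iff_comap_le]
    refine le_trans ?_ (le_sup_right (a := (borel M).comap (X 0)))
    exact le_iSup₂_of_le (f := fun k _ ↦ (borel (TangentBundle 𝓘(ℝ, E) M)).comap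
      (fun w ↦ (⟨X k w, ξ k w⟩ : TangentBundle 𝓘(ℝ, E) M))) n
      (Finset.mem_range.2 (Nat.lt_succ_self n)) le_rfl
  have h2 : Measurable[borel (TangentBundle 𝓘(ℝ, E) M)] φ := by
    borelize (TangentBundle 𝓘(ℝ, E) M)
    exact hφ.measurable
  have h3 : Measurable[hξ.filtration (n + 1)] (fun w ↦ φ ⟨X n w, ξ n w⟩) := h2.comp h1
  exact h3.stronglyMeasurable

variable [IsContinuousRiemannianBundle E (fun y : M ↦ TangentSpace 𝓘(ℝ, E) y)]
  [IsProbabilityMeasure μ] {a : ℕ → ℝ} {H : ∀ y : M, TangentSpace 𝓘(ℝ, E) y}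
  {R : TangentBundle 𝓘(ℝ, E) M → M}

/-- Along the iterates of a Robbins–Monro scheme which stay in a compact set, every compactly
supported smooth function compensated by its drift converges almost surely. -/
theorem ae_exists_tendsto_compensated
    (hH : Continuous (fun y : M ↦ (⟨y, H y⟩ : TangentBundle 𝓘(ℝ, E) M)))
    (hR : IsRetraction E R) (ha_sq : Summable (fun n ↦ a n ^ 2))
    (hX : ∀ n w, X (n + 1) w = R ⟨X n w, a n • (H (X n w) + ξ n w)⟩)
    (hξ : IsMartingaleDifference E μ X ξ)
    (hξ_sq : ∀ᵐ w ∂μ, ⨆ n, (μ⁻[fun w' ↦ ‖ξ n w'‖ₑ ^ 2 | history E X ξ n]) w < ⊤)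
    {f : M → ℝ} (hf : ContMDiff 𝓘(ℝ, E) 𝓘(ℝ, ℝ) ∞ f) (hfc : HasCompactSupport f) {K : Set M}
    (hK : IsCompact K) :
    ∀ᵐ w ∂μ, (∀ n, X n w ∈ K) →
      ∃ l, Tendsto (compensated f (drift f H) a (fun n ↦ X n w)) atTop (𝓝 l) := by
  obtain ⟨B, hB⟩ := hfc.exists_bound_of_continuous hf.continuous
  -- On `K` the remainder must be controlled. The support of `f` is added so that the bound on `df`
  -- holds on all of `M`: the martingale differences are then integrable without restricting to
  -- iterates in `K`.
  obtain ⟨C, hC0, hC⟩ := hR.exists_forall_taylor hf hB (hK.union hfc)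
  obtain ⟨BH, hBH0, hBH⟩ := exists_forall_norm_le_of_isCompact hH hK
  have hdiff : ∀ (x : M) (v : TangentSpace 𝓘(ℝ, E) x), |differential f x v| ≤ C * ‖v‖ := by
    intro x v
    by_cases hx : x ∈ tsupport f
    · exact (hC x (Or.inr hx) v).2
    · rw [differential_eq_zero_of_notMem_tsupport hx]
      simpa using mul_nonneg hC0 (norm_nonneg v)
  set d : ℕ → Ω → ℝ := fun n w ↦ differential f (X n w) (ξ n w) with hd
  have hsm := contMDiff_differential_apply (E := E) hf
  have hdm : ∀ n, StronglyMeasurable[hξ.filtration (n + 1)] (d n) := fun n ↦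
    hξ.stronglyMeasurable_comp n hsm.continuous
  have hdint : ∀ n, Integrable (d n) μ := fun n ↦
    ((hξ.integrable n).const_mul C).mono' ((hdm n).mono (hξ.filtration.le _)).aestronglyMeasurable
      (ae_of_all _ fun w ↦ hdiff _ _)
  have hdcond : ∀ n, μ[d n | hξ.filtration n] =ᵐ[μ] 0 := fun n ↦
    hξ.condExp_eq_zero n (differential f) hsm
      ⟨tsupport f, hfc, fun y hy ↦ differential_eq_zero_of_notMem_tsupport hy⟩
  have hdZ : ∀ n w, ‖d n w‖ₑ ^ 2 ≤ ((C.toNNReal ^ 2 : ℝ≥0) : ℝ≥0∞) * ‖ξ n w‖ₑ ^ 2 := by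
    intro n w
    rw [ENNReal.coe_pow, ← mul_pow]
    gcongr
    have h1 := hdiff (X n w) (ξ n w)
    rw [← ofReal_norm, ← ofReal_norm, ENNReal.ofNNReal_toNNReal, ← ENNReal.ofReal_mul hC0]
    exact ENNReal.ofReal_le_ofReal h1
  have hmart := ae_exists_tendsto_sum_of_condLExp_lt_top (μ := μ) hξ.filtration ha_sq hξ_sq hdm
    hdint hdcond hdZ
  have hb : ∑' n, ENNReal.ofReal (a n ^ 2) ≠ ⊤ := ha_sq.tsum_ofReal_ne_top
  have hZm : ∀ n, AEMeasurable (fun w ↦ ‖ξ n w‖ₑ ^ 2) μ := by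
    intro n
    have h1 := (hξ.integrable n).aestronglyMeasurable.aemeasurable.ennreal_ofReal
    simp only [ofReal_norm] at h1
    exact h1.pow_const 2
  have hsq := ae_tsum_mul_lt_top_of_condLExp_lt_top (μ := μ) hξ.filtration hb hZm hξ_sq
  filter_upwards [hmart, hsq] with w hw hsqw hwK
  obtain ⟨l, hl⟩ := hw
  have hξsum : Summable fun n ↦ a n ^ 2 * ‖ξ n w‖ ^ 2 := by
    have h1 := ENNReal.summable_toReal hsqw.ne
    refine h1.congr fun n ↦ ?_
    rw [ENNReal.toReal_mul, ENNReal.toReal_ofReal (sq_nonneg _), ENNReal.toReal_pow, toReal_enorm]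
  -- The Taylor remainder, at most `C a_n² ‖H + ξ‖²`, is absolutely summable since both `a_n²` and
  -- `a_n² ‖ξ n‖²` are.
  set r : ℕ → ℝ := fun n ↦
    f (X (n + 1) w) - f (X n w) - a n • drift f H (X n w) - a n * d n w with hr
  have hrsum : Summable r := by
    refine Summable.of_norm_bounded (g := fun n ↦ C * (2 * (BH ^ 2 * a n ^ 2
      + a n ^ 2 * ‖ξ n w‖ ^ 2))) (((ha_sq.mul_left _).add hξsum).mul_left 2 |>.mul_left C)
      fun n ↦ ?_
    have h1 := (hC (X n w) (Or.inl (hwK n)) (a n • (H (X n w) + ξ n w))).1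
    have h2 : differential f (X n w) (a n • (H (X n w) + ξ n w))
        = a n • drift f H (X n w) + a n * d n w := by
      rw [map_smul, map_add, smul_add]; rfl
    rw [← hX, h2] at h1
    rw [Real.norm_eq_abs, hr]
    simp only []
    rw [sub_sub _ (a n • drift f H (X n w))]
    refine h1.trans (mul_le_mul_of_nonneg_left ?_ hC0)
    have h3 : ‖H (X n w) + ξ n w‖ ≤ BH + ‖ξ n w‖ :=
      (norm_add_le _ _).trans (by gcongr; exact hBH _ (hwK n))
    rw [norm_smul, mul_pow, Real.norm_eq_abs, sq_abs]
    calc a n ^ 2 * ‖H (X n w) + ξ n w‖ ^ 2 ≤ a n ^ 2 * (BH + ‖ξ n w‖) ^ 2 := by gcongr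
      _ ≤ a n ^ 2 * (2 * (BH ^ 2 + ‖ξ n w‖ ^ 2)) := by
        gcongr
        exact add_sq_le
      _ = _ := by ring
  refine ⟨f (X 0 w) + l + ∑' n, r n, ?_⟩
  refine ((hl.const_add (f (X 0 w))).add hrsum.hasSum.tendsto_sum_nat).congr fun n ↦ ?_
  have h1 : ∑ j ∈ Finset.range n, r j = f (X n w) - f (X 0 w)
      - ∑ j ∈ Finset.range n, a j • drift f H (X j w) - ∑ j ∈ Finset.range n, a j * d j w := by
    simp only [hr, Finset.sum_sub_distrib]
    rw [← Finset.sum_range_sub (fun j ↦ f (X j w)), Finset.sum_sub_distrib]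
  rw [h1, compensated]
  ring

/-- Vector valued version of `ae_exists_tendsto_compensated`. -/
theorem ae_cauchySeq_compensated
    (hH : Continuous (fun y : M ↦ (⟨y, H y⟩ : TangentBundle 𝓘(ℝ, E) M)))
    (hR : IsRetraction E R) (ha_sq : Summable (fun n ↦ a n ^ 2))
    (hX : ∀ n w, X (n + 1) w = R ⟨X n w, a n • (H (X n w) + ξ n w)⟩)
    (hξ : IsMartingaleDifference E μ X ξ)
    (hξ_sq : ∀ᵐ w ∂μ, ⨆ n, (μ⁻[fun w' ↦ ‖ξ n w'‖ₑ ^ 2 | history E X ξ n]) w < ⊤)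
    {V : Type*} [NormedAddCommGroup V] [NormedSpace ℝ V] [FiniteDimensional ℝ V]
    {F : M → V} (hF : ContMDiff 𝓘(ℝ, E) 𝓘(ℝ, V) ∞ F) (hFc : HasCompactSupport F) {K : Set M}
    (hK : IsCompact K) :
    ∀ᵐ w ∂μ, (∀ n, X n w ∈ K) →
      CauchySeq (compensated F (drift F H) a (fun n ↦ X n w)) := by
  set b := (Module.finBasis ℝ V).equivFunL with hb
  set ℓ : Fin (Module.finrank ℝ V) → V →L[ℝ] ℝ := fun i ↦
    (ContinuousLinearMap.proj i).comp (b : V →L[ℝ] Fin (Module.finrank ℝ V) → ℝ) with hℓ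
  have key : ∀ i, ∀ᵐ w ∂μ, (∀ n, X n w ∈ K) → ∃ l, Tendsto
      (compensated (fun x ↦ ℓ i (F x)) (drift (fun x ↦ ℓ i (F x)) H) a (fun n ↦ X n w))
      atTop (𝓝 l) := fun i ↦
    ae_exists_tendsto_compensated hH hR ha_sq hX hξ hξ_sq ((ℓ i).contMDiff.comp hF)
      (hFc.comp_left (map_zero (ℓ i))) hK
  filter_upwards [ae_all_iff.2 key] with w hw hwK
  choose l hl using fun i ↦ hw i hwK
  have hcoord : ∀ n i, compensated (fun x ↦ ℓ i (F x)) (drift (fun x ↦ ℓ i (F x)) H) a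
      (fun n ↦ X n w) n = b (compensated F (drift F H) a (fun n ↦ X n w) n) i := by
    intro n i
    change _ = ℓ i (compensated F (drift F H) a (fun n ↦ X n w) n)
    simp only [compensated, map_sub, map_sum, map_smul]
    congr 1
    exact Finset.sum_congr rfl fun j _ ↦ congrArg _ (differential_clm_comp hF (ℓ i) _ _)
  have h1 : Tendsto (fun n ↦ b (compensated F (drift F H) a (fun n ↦ X n w) n)) atTop (𝓝 l) :=
    tendsto_pi_nhds.2 fun i ↦ (hl i).congr fun n ↦ hcoord n i
  have h2 := (b.symm.continuous.tendsto l).comp h1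
  refine Tendsto.cauchySeq (x := b.symm l) (h2.congr fun n ↦ ?_)
  simp

end Noise

end RiemannianSA

end

/-! ### The main theorem -/

theorem theorem1
    {E : Type*} [NormedAddCommGroup E] [NormedSpace ℝ E] [FiniteDimensional ℝ E]
    -- a connected smooth Riemannian manifold with its Riemannian distance
    {M : Type*} [MetricSpace M] [SecondCountableTopology M]
    [ChartedSpace E M] [IsManifold 𝓘(ℝ, E) ∞ M]
    [RiemannianBundle (fun y : M ↦ TangentSpace 𝓘(ℝ, E) y)]
    [IsContMDiffRiemannianBundle 𝓘(ℝ, E) ∞ E (fun y : M ↦ TangentSpace 𝓘(ℝ, E) y)]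
    [IsRiemannianManifold 𝓘(ℝ, E) M]
    -- the injectivity radius is bounded away from zero
    (r₀ : ℝ) (hr₀ : 0 < r₀)
    (hinj : ∀ y : M, ENNReal.ofReal r₀ ≤ RiemannianSA.injRadius E y)
    -- a smooth vector field
    (H : ∀ y : M, TangentSpace 𝓘(ℝ, E) y)
    (hH : ContMDiff 𝓘(ℝ, E) 𝓘(ℝ, E).tangent ∞
      (fun y : M ↦ (⟨y, H y⟩ : TangentBundle 𝓘(ℝ, E) M)))
    -- a retraction
    (R : TangentBundle 𝓘(ℝ, E) M → M) (hR : RiemannianSA.IsRetraction E R)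
    -- step sizes
    (a : ℕ → ℝ) (ha_pos : ∀ n, 0 < a n) (ha_sum : ¬ Summable a)
    (ha_sq : Summable (fun n ↦ a n ^ 2))
    -- the iterates `X n` and the noise `ξ n` (the value of `M_{n+1}`), tangent at `X n`
    {Ω : Type*} {mΩ : MeasurableSpace Ω} (μ : Measure Ω) [IsProbabilityMeasure μ]
    (X : ℕ → Ω → M) (ξ : ∀ (n : ℕ) (w : Ω), TangentSpace 𝓘(ℝ, E) (X n w))
    (hX : ∀ n w, X (n + 1) w = R ⟨X n w, a n • (H (X n w) + ξ n w)⟩)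
    (hξ : RiemannianSA.IsMartingaleDifference E μ X ξ)
    (hξ_sq : ∀ᵐ w ∂μ,
      ⨆ n, (μ⁻[fun w' ↦ ‖ξ n w'‖ₑ ^ 2 | RiemannianSA.history E X ξ n]) w < ⊤)
    -- the iterates remain in a compact set, which may depend on the sample point
    (hX_cpt : ∀ᵐ w ∂μ, ∃ K : Set M, IsCompact K ∧ ∀ n, X n w ∈ K)
    -- the geodesic interpolation of the iterates
    (x : ℝ → Ω → M)
    (hx : ∀ w, RiemannianSA.IsGeodesicInterpolation E r₀ a (fun n ↦ X n w) (fun t ↦ x t w)) :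
    ∀ T : ℝ, 0 < T → ∀ᵐ w ∂μ,
      -- for large `s` the solution of `y' = H y` with `y s = x s` exists on `[s, s + T]`
      (∀ᶠ s : ℝ in atTop, ∃ y : ℝ → M,
        IsMIntegralCurveOn y H (Icc s (s + T)) ∧ y s = x s w) ∧
      -- and the distance of `x` to it on `[s, s + T]` tends to `0`
      ∀ xs : ℝ → ℝ → M,
        (∀ᶠ s : ℝ in atTop, IsMIntegralCurveOn (xs s) H (Icc s (s + T)) ∧ xs s s = x s w) →
        Tendsto (fun s : ℝ ↦ ⨆ t ∈ Icc s (s + T), edist (x t w) (xs s t)) atTop (𝓝 0) := by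
  have : IsContinuousRiemannianBundle E (fun y : M ↦ TangentSpace 𝓘(ℝ, E) y) := by
    obtain ⟨g, hg, h⟩ := IsContMDiffRiemannianBundle.exists_contMDiff (IB := 𝓘(ℝ, E)) (n := ∞)
      (F := E) (E := fun y : M ↦ TangentSpace 𝓘(ℝ, E) y)
    exact ⟨g, hg.continuous, h⟩
  have : LocallyCompactSpace M := Manifold.locallyCompact_of_finiteDimensional 𝓘(ℝ, E)
  -- Countably many deterministic compact sets, so that the exceptional null sets can be united
  -- before the random compact set is enclosed in one of them. Iterates in `K m` are tracked in `K
  -- (m + 1)`, which leaves room for the solution.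
  let K := CompactExhaustion.choice M
  have hmain : ∀ m, ∃ (t : Finset M) (F : M → t → E × ℝ), ContMDiff 𝓘(ℝ, E) 𝓘(ℝ, t → E × ℝ) ∞ F ∧
      HasCompactSupport F ∧ InjOn F (K (m + 1)) ∧ ∃ L ≥ 0, ∀ p ∈ K (m + 1), ∀ q ∈ K (m + 1),
        ‖RiemannianSA.drift F H p - RiemannianSA.drift F H q‖ ≤ L * ‖F p - F q‖ := by
    intro m
    obtain ⟨t, F, hF, hFc, hFinj, hL⟩ :=
      RiemannianSA.exists_contMDiff_injOn_forall_norm_sub_le (E := E) (K.isCompact (m + 1))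
    exact ⟨t, F, hF, hFc, hFinj, hL _ (RiemannianSA.contMDiff_drift hF hH)⟩
  choose _ F hF hFc hFinj L hL0 hL using hmain
  have hconv : ∀ m, ∀ᵐ w ∂μ, (∀ n, X n w ∈ K m) →
      CauchySeq (RiemannianSA.compensated (F m) (RiemannianSA.drift (F m) H) a (fun n ↦ X n w)) :=
    fun m ↦ RiemannianSA.ae_cauchySeq_compensated hH.continuous hR ha_sq hX hξ hξ_sq (hF m)
      (hFc m) (K.isCompact m)
  have ha0 : Tendsto a atTop (𝓝 0) := by
    have h1 := ha_sq.tendsto_atTop_zero.sqrt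
    simp only [Real.sqrt_zero] at h1
    exact h1.congr fun n ↦ Real.sqrt_sq (ha_pos n).le
  have hat := RiemannianSA.tendsto_stepTime ha_pos ha_sum
  intro T hT
  filter_upwards [ae_all_iff.2 hconv, hX_cpt] with w hw ⟨K₀, hK₀, hXK₀⟩
  obtain ⟨m, hm⟩ := K.exists_superset_of_isCompact hK₀
  have hXK : ∀ n, X n w ∈ K m := fun n ↦ hm (hXK₀ n)
  obtain ⟨G, hG⟩ := ((K.isCompact (m + 1)).image
    (RiemannianSA.contMDiff_drift (hF m) hH).continuous.norm).bddAbove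
  have htrack : ∀ δ > 0, ∀ᶠ s in atTop, ∀ y : ℝ → M, y s = x s w →
      ContinuousOn y (Icc s (s + T)) →
      (∀ r ∈ Icc s (s + T), y r ∈ K (m + 1) →
        HasDerivWithinAt (F m ∘ y) (RiemannianSA.drift (F m) H (y r)) (Icc s (s + T)) r) →
      ∀ t ∈ Icc s (s + T), y t ∈ interior (K (m + 1)) ∧ dist (x t w) (y t) < δ := fun δ hδ ↦
    RiemannianSA.eventually_forall_dist_lt (K.isCompact m) (K.isCompact (m + 1))
      (K.subset_interior_succ m) (hF m).continuous (hFinj m) (hL0 m) (le_max_right G 0) (hL m)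
      (fun p hp ↦ (hG ⟨p, hp, rfl⟩).trans (le_max_left _ _)) ha_pos ha0 hat hXK (hw m hXK)
      (hx w).apply_stepTime hr₀ (fun n hn t ht ↦ (hx w).dist_le hn ht) hT.le hδ
  refine ⟨?_, fun xs hxs ↦ ?_⟩
  -- The field `χ • H` equals `H` on `K (m + 1)` and vanishes outside `K (m + 2)`, hence is
  -- complete. Tracking asks for the equation only while the curve is in `K (m + 1)`, so it applies
  -- to this flow and confines it there.
  · obtain ⟨χ, hχ1, hχ0, -⟩ := exists_contMDiffMap_one_nhds_of_subset_interior (n := ⊤) 𝓘(ℝ, E)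
      (K.isCompact (m + 1)).isClosed (K.subset_interior_succ (m + 1))
    have hχK : ∀ p ∈ K (m + 1), χ p = 1 := fun p hp ↦ hχ1.self_of_nhdsSet p hp
    have hsmooth := (χ.contMDiff.smul_section hH).of_le (show 1 ≤ ((⊤ : ℕ∞) : WithTop ℕ∞) by simp)
    filter_upwards [htrack 1 one_pos] with s hs
    obtain ⟨γ, hγ0, hγ⟩ := RiemannianSA.exists_isMIntegralCurve_of_isCompact hsmooth
      (K.isCompact (m + 1 + 1)) (fun p hp ↦ by
        change χ p • H p = 0
        rw [hχ0 p hp, zero_smul]) (x s w)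
    have hy := (isMIntegralCurve_comp_sub (dt := s)).2 hγ
    set y : ℝ → M := γ ∘ (· - s) with hydef
    have hys : y s = x s w := by simp [hydef, hγ0]
    have hyH : ∀ r, y r ∈ K (m + 1) → HasMFDerivWithinAt 𝓘(ℝ, ℝ) 𝓘(ℝ, E) y (Icc s (s + T)) r
        ((1 : ℝ →L[ℝ] ℝ).smulRight (H (y r))) := by
      intro r hr
      have h1 := (hy r).hasMFDerivWithinAt (s := Icc s (s + T))
      have h2 : (⇑χ • H) (y r) = H (y r) := by
        change χ (y r) • H (y r) = H (y r)
        rw [hχK _ hr, one_smul]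
      rwa [h2] at h1
    refine ⟨y, fun r hr ↦ hyH r ?_, hys⟩
    exact interior_subset (hs y hys hy.continuous.continuousOn (fun r _ hrK ↦
      RiemannianSA.hasDerivWithinAt_comp_of_hasMFDerivWithinAt (hF m) (hyH r hrK)) r hr).1
  · rw [ENNReal.tendsto_nhds_zero]
    intro ε hε
    obtain ⟨δ, hδ, hδε⟩ : ∃ δ : ℝ, 0 < δ ∧ ENNReal.ofReal δ ≤ ε := by
      -- The minimum with `1` covers the case `ε = ⊤`.
      refine ⟨(min ε 1).toReal, ENNReal.toReal_pos (by simp [hε.ne']) (by simp), ?_⟩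
      rw [ENNReal.ofReal_toReal (by simp)]
      exact min_le_left _ _
    filter_upwards [htrack δ hδ, hxs] with s hs ⟨hcurve, hstart⟩
    refine iSup₂_le fun r hr ↦ ?_
    have h1 := (hs (xs s) hstart hcurve.continuousOn (fun r hr _ ↦
      RiemannianSA.hasDerivWithinAt_comp_of_hasMFDerivWithinAt (hF m) (hcurve r hr)) r hr).2
    rw [edist_dist]
    exact (ENNReal.ofReal_le_ofReal h1.le).trans hδε
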